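/- **Setting.** For $\beta\in(0,2]$ and $L>0$ let $\Sigma(\beta,L)$ be the class of $f:[0,1]\to\mathbb R$ that are $\lceil\beta\rceil-1$ times differentiable with $|f^{(\lceil\beta\rceil-1)}(x)-f^{(\lceil\beta\rceil-1)}(y)|\le L|x-y|^{\beta+1-\lceil\beta\rceil}$ for all $x,y\in[0,1]$, and let $H\subseteq\Sigma(\beta,L)$ be the subclass of monotone increasing functions. One observes $Y_i=f(x_i)+\varepsilon_i$, $x_i=i/n$, $i=1,\dots,n$, with i.i.d. errors $\varepsilon_i\sim N(0,\sigma^2)$, $\sigma>0$ known, and tests $H$. For $\delta>0$ put $$\mathcal F_\beta(\delta)=\begin{cases}\{f\in\Sigma(\beta,L):\max_{0\le a<b\le1}(f(a)-f(b))\ge\delta\},&\beta\in(0,1],\\ \{f\in\Sigma(\beta,L):\min_{x\in[0,1]}f'(x)\le-\delta\},&\beta\in(1,2],\end{cases}\qquad \Delta_{\beta,n}=\Big(\frac{\log n}{n}\Big)^{\frac{\beta-\lceil\beta\rceil+1}{2\beta+1}}.$$ **Kernel and constants.** Let $K:\mathbb R\to[0,\infty)$ be symmetric, vanish outside $[-1,1]$,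 satisfy $\int K=1$, be bounded above by $K_{\max}$, bounded below by a positive constant on a neighbourhood of $0$, and Lipschitz with constant $L_K>0$. Let $\lambda_0>0$ be a constant, and set $C_*=8K_{\max}/\lambda_0$, $q_1=C_*L/(\lceil\beta\rceil-1)!$, $q_2=\sigma^2\frac{16\lceil\beta\rceil}{\lambda_0^2}\int K^2$, $C_h=(q_2/(4q_1^2\beta))^{1/(2\beta+1)}$, $h_n=C_h(\log n/n)^{1/(2\beta+1)}$, $L_1=\sqrt e\,(L_K+K_{\max})$, $L_2=2\lceil\beta\rceil K_{\max}+\lceil\beta\rceil L_K$, $\widetilde C_*=L_1/(8L_2)+\sqrt e\,K_{\max}/\lambda_0$, $W=\max(4C_*^2,4\widetilde C_*^2)$. For $\alpha\in(0,1)$ let $C_n(\alpha)=-2\log(\alpha/2)h_n^{-1}$ and $N_{\max}=\frac{40}{\log 2}C_n(\alpha)\log^2n$. **The test FOMT.** With $U(u)=(1,u,\dots,u^k/k!)^\top$ and $k=\lceil\beta\rceil-1$, let $\hat f_n(x)=\langle\hat\theta_n(x),U(0)\rangle$ be the local polynomial estimator of order $k$, where $\hat\theta_n(x)$ minimizes $\theta\mapsto\sum_{i=1}^n\big(Y_i-\langle\theta,U(\tfrac{x_i-x}{h_n})\rangle\big)^2K(\tfrac{x_i-x}{h_n})$.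 For $i<j$ the local test rejects, $\Phi_{i,j}=1$, iff $\hat f_n(x_i)-\hat f_n(x_j)\ge C_{n,\alpha,i,j}+D_{n,\beta,i,j}$, where $$C_{n,\alpha,i,j}=\sigma\sqrt{-2\log(\alpha/N_{\max})\,W}\;n^{-1/2}h_n^{-3/2}\min\Big(\frac{8L_2}{\lambda_0}|x_i-x_j|,\,h_n\Big),$$ and $D_{n,\beta,i,j}=0$ if $x_i,x_j\in[h_n,1-h_n]$, $D_{n,\beta,i,j}=\max(16K_{\max}/\lambda_0,2)Lh_n^\beta$ otherwise. FOMT repeats $\lceil C_n(\alpha)\rceil$ times, with independent draws: draw $I$ uniformly from $\{1,\dots,n\}$; if $I\le n-1$, repeat $\lceil20\log n\rceil$ times: for $0\le k\le\lceil\log_2(n-I)\rceil$ draw $J$ uniformly from $\{1,\dots,\min(2^k,n-I)\}$ and perform $\Phi_{I,I+J}$; if $I\ge2$, repeat $\lceil20\log n\rceil$ times: for $0\le k\le\lceil\log_2(I-1)\rceil$ draw $J$ uniformly from $\{1,\dots,\min(2^k,I-1)\}$ and perform $\Phi_{I-J,I}$. It rejects ($\Phi=1$) as soon as some local test rejects;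 if none does, it accepts ($\Phi=0$). **Theorem (minimax optimality).** There are constants $0<c<C<\infty$, depending on $\beta$ and on the fixed quantities $L,\sigma,K,K_{\max},L_K,\lambda_0$ but not on $n$ or $\alpha$, such that for every $\alpha\in(0,1)$: (i) (upper bound) FOMT $\Phi$ at level $\alpha$ satisfies $$\liminf_{n\to\infty}\ \inf_{f\in\mathcal F_\beta(C\Delta_{\beta,n})}\mathbb P_f(\Phi=1)\ \ge\ 1-\alpha .$$ (ii) (lower bound) For every sequence $\Psi=(\Psi_n)$ of (possibly randomized, measurable) tests based on $Y_1,\dots,Y_n$ with $\limsup_{n\to\infty}\sup_{f\in H}\mathbb P_f(\Psi_n=1)\le\alpha$, $$\limsup_{n\to\infty}\ \inf_{f\in\mathcal F_\beta(c\Delta_{\beta,n})}\mathbb P_f(\Psi_n=1)\ \le\ \alpha .$$ In this sense $\Delta_{\beta,n}$ is the minimax separation rate and FOMT attains it. -/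

import Mathlib

open MeasureTheory ProbabilityTheory Filter Set
open scoped ENNReal NNReal

noncomputable section

namespace FOMT

/-! ### Function classes -/

/-- The order `⌈β⌉ - 1` of the highest derivative in the Hölder class of smoothness `β > 0`. -/
def order (β : ℝ) : ℕ := ⌈β⌉₊ - 1

/-- The Hölder class `Σ(β, L)` on `[0,1]`. A function on `[0,1]` is represented by a function on `ℝ`
whose values outside `[0,1]` are irrelevant; derivatives are taken within `[0,1]`
(one-sided at the end points). -/
def holderClass (β L : ℝ) : Set (ℝ → ℝ) :=
  {f | ContDiffOn ℝ (order β) f (Icc 0 1) ∧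
    ∀ x ∈ Icc (0 : ℝ) 1, ∀ y ∈ Icc (0 : ℝ) 1,
      |iteratedDerivWithin (order β) f (Icc 0 1) x - iteratedDerivWithin (order β) f (Icc 0 1) y|
        ≤ L * |x - y| ^ (β + 1 - (⌈β⌉₊ : ℝ))}

/-- The null hypothesis `H`: functions in `Σ(β, L)` that are monotone increasing on `[0,1]`. -/
def nullClass (β L : ℝ) : Set (ℝ → ℝ) :=
  {f | f ∈ holderClass β L ∧ MonotoneOn f (Icc 0 1)}

/-- The alternatives `𝓕_β(δ)`. For `β ≤ 1`: `max_{0 ≤ a < b ≤ 1} (f a - f b) ≥ δ`.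
For `β > 1`: `min_{x ∈ [0,1]} f' x ≤ -δ`. (For `δ > 0` the extrema are attained, so that these
conditions are existential.) -/
def altClass (β L δ : ℝ) : Set (ℝ → ℝ) :=
  {f | f ∈ holderClass β L ∧
    if β ≤ 1 then ∃ a b : ℝ, 0 ≤ a ∧ a < b ∧ b ≤ 1 ∧ δ ≤ f a - f b
    else ∃ x ∈ Icc (0 : ℝ) 1, derivWithin f (Icc 0 1) x ≤ -δ}

/-- The rate `Δ_{β,n} = (log n / n)^((β - ⌈β⌉ + 1) / (2β + 1))`. -/
def sepRate (β : ℝ) (n : ℕ) : ℝ :=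
  (Real.log n / n) ^ ((β - (⌈β⌉₊ : ℝ) + 1) / (2 * β + 1))

/-! ### The regression model and tests -/

/-- The design point `x_i = i / n`. -/
def design (n i : ℕ) : ℝ := (i : ℝ) / n

/-- The law `P_f` of the data `(Y_1, …, Y_n)`, where the `Y_i = f (i / n) + ε_i` have
independent `N(0, σ²)` errors. The coordinate `i : Fin n` is `Y_{i+1}`. -/
def dataLaw (σ : ℝ) (n : ℕ) (f : ℝ → ℝ) : Measure (Fin n → ℝ) :=
  Measure.pi fun i : Fin n => gaussianReal (f (design n (i + 1))) (Real.toNNReal (σ ^ 2))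

/-- A (possibly randomized) test: given the data it returns a random decision,
`true` for rejection. Non-randomized tests are those with values of the form `PMF.pure b`. -/
abbrev RandTest (n : ℕ) := (Fin n → ℝ) → PMF Bool

/-- The rejection probability `P_f (Ψ = 1)`, over the data and the randomness of the test. -/
def rejProb (σ : ℝ) {n : ℕ} (Ψ : RandTest n) (f : ℝ → ℝ) : ℝ≥0∞ :=
  ∫⁻ y, Ψ y true ∂(dataLaw σ n f)

/-! ### Local polynomial estimators -/

/-- The vector `U(u) = (1, u, u²/2!, …, u^k/k!)`. -/
def polyVec (k : ℕ) (u : ℝ) : Fin (k + 1) → ℝ :=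
  fun l => u ^ (l : ℕ) / (Nat.factorial l : ℝ)

/-- The locally weighted sum of squares at `x`. -/
def lpeObjective (K : ℝ → ℝ) (h : ℝ) (k : ℕ) {n : ℕ} (y : Fin n → ℝ) (x : ℝ)
    (θ : Fin (k + 1) → ℝ) : ℝ :=
  ∑ i : Fin n, (y i - dotProduct θ (polyVec k ((design n (i + 1) - x) / h))) ^ 2
    * K ((design n (i + 1) - x) / h)

/-- A minimizer of the locally weighted sum of squares
(an arbitrary one where it is not unique). -/
def lpeCoeff (K : ℝ → ℝ) (h : ℝ) (k : ℕ) {n : ℕ} (y : Fin n → ℝ) (x : ℝ) : Fin (k + 1) → ℝ :=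
  Classical.epsilon fun θ : Fin (k + 1) → ℝ =>
    ∀ θ' : Fin (k + 1) → ℝ, lpeObjective K h k y x θ ≤ lpeObjective K h k y x θ'

/-- The local polynomial estimator of order `k` with kernel `K` and bandwidth `h` at `x`. -/
def lpe (K : ℝ → ℝ) (h : ℝ) (k : ℕ) {n : ℕ} (y : Fin n → ℝ) (x : ℝ) : ℝ :=
  dotProduct (lpeCoeff K h k y x) (polyVec k 0)

/-! ### Parameters of the test -/

/-- The known quantities on which the test is built: smoothness `β`, radius `L`, standard
deviation `σ`, kernel `K`, an upper bound `Kmax` and a Lipschitz constant `LK` of `K`, and the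
constant `lam` that stands for a lower bound of the eigenvalues of the local design matrices. -/
structure Params where
  β : ℝ
  L : ℝ
  σ : ℝ
  K : ℝ → ℝ
  Kmax : ℝ
  LK : ℝ
  lam : ℝ

/-- The standing assumptions on the parameters. No relation between `lam > 0` and the local
design matrices is required. -/
structure Params.Admissible (p : Params) : Prop where
  β_pos : 0 < p.β
  β_le : p.β ≤ 2
  L_pos : 0 < p.L
  σ_pos : 0 < p.σ
  K_nonneg : ∀ u, 0 ≤ p.K u
  K_integral : ∫ u, p.K u = 1
  K_support : ∀ u, 1 < |u| → p.K u = 0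
  K_lower : ∃ Kmin δ : ℝ, 0 < Kmin ∧ 0 < δ ∧ ∀ u, |u| ≤ δ → Kmin ≤ p.K u
  K_upper : ∀ u, p.K u ≤ p.Kmax
  LK_pos : 0 < p.LK
  K_lipschitz : ∀ u v, |p.K u - p.K v| ≤ p.LK * |u - v|
  K_symm : ∀ u, p.K (-u) = p.K u
  lam_pos : 0 < p.lam

namespace Params

variable (p : Params)

/-- `C_* = 8 K_max / λ₀`. -/
def Cstar : ℝ := 8 * p.Kmax / p.lam

/-- `q₁ = C_* L / (⌈β⌉ - 1)!`. -/
def q1 : ℝ := p.Cstar * p.L / (Nat.factorial (order p.β) : ℝ)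

/-- `q₂ = σ² (16 ⌈β⌉ / λ₀²) ∫ K²`. -/
def q2 : ℝ := p.σ ^ 2 * (16 * (⌈p.β⌉₊ : ℝ) / p.lam ^ 2) * ∫ u, p.K u ^ 2

/-- `C_h = (q₂ / (4 q₁² β))^(1 / (2β + 1))`. -/
def Ch : ℝ := (p.q2 / (4 * p.q1 ^ 2 * p.β)) ^ (1 / (2 * p.β + 1))

/-- The bandwidth `h_n = C_h (log n / n)^(1 / (2β + 1))`. -/
def bandwidth (n : ℕ) : ℝ := p.Ch * (Real.log n / n) ^ (1 / (2 * p.β + 1))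

/-- `L₁ = √e L_K + √e K_max`. -/
def L1 : ℝ := √(Real.exp 1) * p.LK + √(Real.exp 1) * p.Kmax

/-- `L₂ = 2 ⌈β⌉ K_max + ⌈β⌉ L_K`. -/
def L2 : ℝ := 2 * (⌈p.β⌉₊ : ℝ) * p.Kmax + (⌈p.β⌉₊ : ℝ) * p.LK

/-- `L₁ / (8 L₂) + √e K_max / λ₀`. -/
def CstarTilde : ℝ := p.L1 / (8 * p.L2) + √(Real.exp 1) * p.Kmax / p.lam

/-- The variance constant `W = max (4 C_*²) (4 C̃_*²)`. -/
def W : ℝ := max (4 * p.Cstar ^ 2) (4 * p.CstarTilde ^ 2)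

/-- `C_n(α) = -2 log(α / 2) / h_n`. -/
def Cn (α : ℝ) (n : ℕ) : ℝ := -2 * Real.log (α / 2) * (p.bandwidth n)⁻¹

/-- `N_max = (40 / log 2) C_n(α) (log n)²`. -/
def Nmax (α : ℝ) (n : ℕ) : ℝ := 40 / Real.log 2 * p.Cn α n * Real.log n ^ 2

/-- The stochastic part `C_{n,α,i,j}` of the critical value. -/
def critRandom (α : ℝ) (n i j : ℕ) : ℝ :=
  p.σ * √(-2 * Real.log (α / p.Nmax α n) * p.W) * (n : ℝ) ^ (-(1 / 2) : ℝ)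
    * p.bandwidth n ^ (-(3 / 2) : ℝ)
    * min (8 * p.L2 / p.lam * |design n i - design n j|) (p.bandwidth n)

open Classical in
/-- The deterministic part `D_{n,β,i,j}` of the critical value. -/
def critBias (n i j : ℕ) : ℝ :=
  if design n i ∈ Icc (p.bandwidth n) (1 - p.bandwidth n) ∧
      design n j ∈ Icc (p.bandwidth n) (1 - p.bandwidth n) then 0
  else max (16 * p.Kmax / p.lam) 2 * p.L * p.bandwidth n ^ p.β

/-- The critical value `q_{n,β,i,j}(α)`. -/
def crit (α : ℝ) (n i j : ℕ) : ℝ := p.critRandom α n i j + p.critBias n i j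

/-- The estimator `f̂_n(x_i)`, of order `⌈β⌉ - 1` and with bandwidth `h_n`. -/
def estimate {n : ℕ} (y : Fin n → ℝ) (i : ℕ) : ℝ :=
  lpe p.K (p.bandwidth n) (order p.β) y (design n i)

open Classical in
/-- The local test `Φ_{i,j}`: it rejects iff `f̂_n(x_i) - f̂_n(x_j) ≥ q_{n,β,i,j}(α)`. -/
def localTest (α : ℝ) {n : ℕ} (y : Fin n → ℝ) (i j : ℕ) : Bool :=
  decide (p.crit α n i j ≤ p.estimate y i - p.estimate y j)

end Params

/-! ### The algorithm -/

/-- The uniform distribution on `{1, …, m}` (for `m ≥ 1`). -/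
def unif (m : ℕ) : PMF ℕ :=
  PMF.uniformOfFinset (Finset.Icc 1 (max m 1))
    (Finset.nonempty_Icc.mpr (le_max_right m 1))

/-- Run `a`; stop with `true` if it returns `true`, otherwise go on with `b`. -/
def orElse (a b : PMF Bool) : PMF Bool :=
  a.bind fun r => if r then PMF.pure true else b

/-- Run independently `a 0, a 1, …, a (N - 1)`; stop with `true` as soon as one of them returns
`true`, and return `false` if none does. -/
def loop : (N : ℕ) → (a : ℕ → PMF Bool) → PMF Bool
  | 0, _ => PMF.pure false
  | N + 1, a => orElse (a 0) (loop N fun k => a (k + 1))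

namespace Params

variable (p : Params)

/-- The search to the right of `x_I` (for `I ≤ n - 1`): `⌈20 log n⌉` times, for
`0 ≤ k ≤ ⌈log₂ (n - I)⌉`, draw `J` uniformly from `{1, …, min (2^k) (n - I)}` and perform
the local test of the pair `(I, I + J)`. -/
def searchRight (α : ℝ) {n : ℕ} (y : Fin n → ℝ) (I : ℕ) : PMF Bool :=
  loop ⌈20 * Real.log n⌉₊ fun _ =>
    loop (Nat.clog 2 (n - I) + 1) fun k =>
      (unif (min (2 ^ k) (n - I))).bind fun J => PMF.pure (p.localTest α y I (I + J))

/-- The search to the left of `x_I` (for `I ≥ 2`): `⌈20 log n⌉` times, for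
`0 ≤ k ≤ ⌈log₂ (I - 1)⌉`, draw `J` uniformly from `{1, …, min (2^k) (I - 1)}` and perform
the local test of the pair `(I - J, I)`. -/
def searchLeft (α : ℝ) {n : ℕ} (y : Fin n → ℝ) (I : ℕ) : PMF Bool :=
  loop ⌈20 * Real.log n⌉₊ fun _ =>
    loop (Nat.clog 2 (I - 1) + 1) fun k =>
      (unif (min (2 ^ k) (I - 1))).bind fun J => PMF.pure (p.localTest α y (I - J) I)

/-- The test FOMT: `⌈C_n(α)⌉` times, draw `I` uniformly from `{1, …, n}` and search
to the right and to the left of `x_I`; reject as soon as a local test rejects. -/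
def fomt (α : ℝ) (n : ℕ) : RandTest n := fun y =>
  loop ⌈p.Cn α n⌉₊ fun _ =>
    (unif n).bind fun I =>
      orElse (if I + 1 ≤ n then p.searchRight α y I else PMF.pure false)
        (if 2 ≤ I then p.searchLeft α y I else PMF.pure false)

end Params

end FOMT

end

/-!
# Minimax optimality of a randomized multiscale test for monotonicity

*Upper bound.* An alternative far from the null drops by a large multiple of `h ^ β` from every
point of one window of length `2 h` to every point of a second window to its right
(`Params.Admissible.exists_windows`). Given `i` in the first and `j` in the second window, each
index between them violates monotonicity with `i` or with `j`, by at least half the drop. Hence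
all indices of one of the two windows are *good*: at least half of the indices between them and some
partner violate monotonicity with them (`Params.good_of_windows`). A dyadic scale finds such a
violation with probability at least `1/4` per draw, and good indices have proportion at least `h`,
so the `⌈2 log (2/α) / h⌉` rounds of the algorithm miss a violation with probability at most `α / 2`
(`Params.accProb_fomt_le`).

A violating pair is rejected by the local test because its drop exceeds the critical value, which
is of order `h ^ β` (`Params.Admissible.exists_crit_le`), and the errors of the estimator at all
design points, which are of order `h ^ β` with high probability. For the latter, the minimality of
least squares together with a uniform lower bound for the design matrices
(`le_sum_kernel_mul_sq`) reduces the error to the weighted moments of the residuals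
(`abs_lpe_sub_le`): their deterministic part is the Taylor remainder, and their Gaussian part is
controlled by a Chernoff bound and a union bound, as `n h ^ (2 β + 1)` is a multiple of `log n`.
The constant `λ₀` enters only through the critical values, so its relation to the true design
matrices is irrelevant for the power.

*Lower bound.* About `1 / (2 r)` disjointly supported bumps of radius
`r = ρ (log n / n) ^ (1 / (2 β + 1))`, with height of order `r ^ β`, belong to the alternative, while
the squared norm of their mean vectors is a small multiple of `log n`. The `χ²`-distance between
their uniform mixture and pure noise is at most `n ^ (1/10)` divided by the number of bumps and
tends to `0`, so a test cannot reject every bump much more often than it rejects the zero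
function, which is in the null hypothesis (`exists_rejProb_le`).
-/

/-! ### The acceptance probability of the randomized search -/

namespace FOMT

/-- The probability that a randomized decision is an acceptance, as a real number. -/
noncomputable def accProb (a : PMF Bool) : ℝ := (a false).toReal

lemma accProb_nonneg (a : PMF Bool) : 0 ≤ accProb a := ENNReal.toReal_nonneg

lemma accProb_le_one (a : PMF Bool) : accProb a ≤ 1 :=
  ENNReal.toReal_le_of_le_ofReal zero_le_one (by simpa using a.coe_le_one false)

lemma apply_true_eq (a : PMF Bool) : a true = ENNReal.ofReal (1 - accProb a) := by
  have h : a true + a false = 1 := by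
    have := a.tsum_coe
    rwa [tsum_bool, add_comm] at this
  have hf : a false ≠ ∞ := a.apply_ne_top false
  have ht : a true ≠ ∞ := a.apply_ne_top true
  have h2 : (a true).toReal = 1 - accProb a := by
    have := congrArg ENNReal.toReal h
    rw [ENNReal.toReal_add ht hf] at this
    simp only [ENNReal.toReal_one] at this
    rw [accProb]; linarith
  rw [← h2, ENNReal.ofReal_toReal ht]

lemma accProb_pure_false : accProb (PMF.pure false) = 1 := by
  simp [accProb]

lemma accProb_pure_true : accProb (PMF.pure true) = 0 := by
  simp [accProb]

lemma accProb_orElse (a b : PMF Bool) : accProb (orElse a b) = accProb a * accProb b := by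
  unfold accProb orElse
  rw [PMF.bind_apply, tsum_bool]
  simp

lemma accProb_loop_le {N : ℕ} (a : ℕ → PMF Bool) {k : ℕ} (hk : k < N) :
    accProb (loop N a) ≤ accProb (a k) := by
  induction N generalizing a k with
  | zero => omega
  | succ N ih =>
    rw [loop, accProb_orElse]
    rcases k with _ | k
    · exact mul_le_of_le_one_right (accProb_nonneg _) (accProb_le_one _)
    · refine (mul_le_of_le_one_left (accProb_nonneg _) (accProb_le_one _)).trans ?_
      exact ih (fun k => a (k + 1)) (by omega)

lemma accProb_loop_const (N : ℕ) (a : PMF Bool) :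
    accProb (loop N fun _ => a) = accProb a ^ N := by
  induction N with
  | zero => simp [loop, accProb_pure_false]
  | succ N ih => rw [loop, accProb_orElse, ih, pow_succ']

lemma accProb_unif_bind {m : ℕ} (hm : 1 ≤ m) (g : ℕ → PMF Bool) :
    accProb ((unif m).bind g) = ∑ J ∈ Finset.Icc 1 m, (m : ℝ)⁻¹ * accProb (g J) := by
  unfold accProb unif
  rw [PMF.bind_apply, tsum_eq_sum (s := Finset.Icc 1 m)]
  · rw [ENNReal.toReal_sum]
    · refine Finset.sum_congr rfl fun J hJ => ?_
      rw [ENNReal.toReal_mul, PMF.uniformOfFinset_apply_of_mem _ (by simpa [hm] using hJ)]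
      simp [hm]
    · intro J _
      exact ENNReal.mul_ne_top (PMF.apply_ne_top _ _) (PMF.apply_ne_top _ _)
  · intro J hJ
    rw [PMF.uniformOfFinset_apply_of_notMem _ (by simpa [hm] using hJ), zero_mul]

/-- If the continuation accepts with probability at most `ε` on a set `V` of outcomes of a uniform
draw, then the draw followed by the continuation accepts with probability at most
`1 - (#V / m) (1 - ε)`. -/
lemma accProb_unif_bind_le {m : ℕ} (hm : 1 ≤ m) (g : ℕ → PMF Bool) {V : Finset ℕ}
    (hV : V ⊆ Finset.Icc 1 m) {ε : ℝ} (hg : ∀ J ∈ V, accProb (g J) ≤ ε) :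
    accProb ((unif m).bind g) ≤ 1 - (V.card : ℝ) / m * (1 - ε) := by
  rw [accProb_unif_bind hm, ← Finset.sum_sdiff hV]
  have hm0 : (0 : ℝ) < m := by exact_mod_cast hm
  have h1 : ∑ J ∈ Finset.Icc 1 m \ V, (m : ℝ)⁻¹ * accProb (g J)
      ≤ ∑ J ∈ Finset.Icc 1 m \ V, (m : ℝ)⁻¹ * 1 :=
    Finset.sum_le_sum fun J _ => mul_le_mul_of_nonneg_left (accProb_le_one _) (by positivity)
  have h2 : ∑ J ∈ V, (m : ℝ)⁻¹ * accProb (g J) ≤ ∑ J ∈ V, (m : ℝ)⁻¹ * ε :=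
    Finset.sum_le_sum fun J hJ => mul_le_mul_of_nonneg_left (hg J hJ) (by positivity)
  have h3 : ((Finset.Icc 1 m \ V).card : ℝ) = m - V.card := by
    rw [Finset.card_sdiff_of_subset hV, Nat.cast_sub (Finset.card_le_card hV)]
    simp
  rw [Finset.sum_const, nsmul_eq_mul, h3] at h1
  rw [Finset.sum_const, nsmul_eq_mul] at h2
  refine (add_le_add h1 h2).trans (le_of_eq ?_)
  field_simp
  ring

/-- The dyadic search succeeds: if at least half of the shifts `J ∈ {1, …, d}` make the test `t`
reject, then one draw at the scale `2 ^ k ∈ [d, 2d)` rejects with probability at least `1/4`. -/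
lemma accProb_dyadic_loop_le {N d : ℕ} (hd : 1 ≤ d) (hdN : d ≤ N) (t : ℕ → Bool)
    {V : Finset ℕ} (hV : V ⊆ Finset.Icc 1 d) (hcard : d ≤ 2 * V.card) (ht : ∀ J ∈ V, t J = true) :
    accProb (loop (Nat.clog 2 N + 1) fun k =>
      (unif (min (2 ^ k) N)).bind fun J => PMF.pure (t J)) ≤ 3 / 4 := by
  have hk : Nat.clog 2 d < Nat.clog 2 N + 1 := Nat.lt_succ_of_le (Nat.clog_mono_right 2 hdN)
  refine (accProb_loop_le _ hk).trans ?_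
  have h1 : d ≤ 2 ^ Nat.clog 2 d := Nat.le_pow_clog one_lt_two d
  have h2 : 2 ^ Nat.clog 2 d ≤ 2 * d := by
    rcases Nat.eq_or_lt_of_le hd with rfl | hd
    · simp
    · have := Nat.pow_pred_clog_lt_self one_lt_two hd
      have hpos : 0 < Nat.clog 2 d := Nat.clog_pos one_lt_two hd
      obtain ⟨c, hc⟩ : ∃ c, Nat.clog 2 d = c + 1 := ⟨_, (Nat.succ_pred_eq_of_pos hpos).symm⟩
      rw [hc] at this ⊢
      rw [Nat.pred_succ] at this
      rw [pow_succ]; omega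
  set m := min (2 ^ Nat.clog 2 d) N with hm
  have hdm : d ≤ m := le_min h1 hdN
  have hm2 : m ≤ 2 * d := (min_le_left _ _).trans h2
  have := accProb_unif_bind_le (hd.trans hdm) (fun J => PMF.pure (t J))
    (hV.trans (Finset.Icc_subset_Icc_right hdm)) (ε := 0)
    (fun J hJ => by rw [ht J hJ, accProb_pure_true])
  refine this.trans ?_
  have hm0 : (0 : ℝ) < m := by exact_mod_cast hd.trans hdm
  have h4 : (m : ℝ) ≤ 4 * V.card := by
    have : m ≤ 4 * V.card := by omega
    exact_mod_cast this
  have h5 : (1 : ℝ) / 4 ≤ V.card / m := by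
    rw [div_le_div_iff₀ (by norm_num) hm0]; linarith
  linarith

lemma three_quarters_pow_le_half {N : ℕ} (hN : 3 ≤ N) : ((3 : ℝ) / 4) ^ N ≤ 1 / 2 :=
  (pow_le_pow_of_le_one (by norm_num) (by norm_num) hN).trans (by norm_num)

namespace Params

variable (p : Params) (α : ℝ) {n : ℕ} (y : Fin n → ℝ)

/-- The index `I` sees many local rejections to its right: for some `j`, at least half of the
indices in `(I, j]` form a rejected pair with `I`. -/
def RightGood (I : ℕ) : Prop :=
  ∃ j ≤ n, I < j ∧ j - I ≤ 2 * ((Finset.Ioc I j).filter fun c => p.localTest α y I c = true).card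

/-- The index `I` sees many local rejections to its left: for some `i ≥ 1`, at least half of the
indices in `[i, I)` form a rejected pair with `I`. -/
def LeftGood (I : ℕ) : Prop :=
  ∃ i, 1 ≤ i ∧ i < I ∧
    I - i ≤ 2 * ((Finset.Ico i I).filter fun c => p.localTest α y c I = true).card

variable {p α y}

lemma accProb_searchRight_le {I : ℕ} (h : p.RightGood α y I) (hn : 3 ≤ ⌈20 * Real.log n⌉₊) :
    accProb (p.searchRight α y I) ≤ 1 / 2 := by
  obtain ⟨j, hjn, hIj, hc⟩ := h
  rw [searchRight, accProb_loop_const]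
  refine (pow_le_pow_left₀ (accProb_nonneg _) ?_ _).trans (three_quarters_pow_le_half hn)
  refine accProb_dyadic_loop_le (d := j - I) (by omega) (by omega)
    (fun J => p.localTest α y I (I + J))
    (V := (Finset.Icc 1 (j - I)).filter fun J => p.localTest α y I (I + J) = true)
    (Finset.filter_subset _ _) ?_ (fun J hJ => (Finset.mem_filter.mp hJ).2)
  refine hc.trans (Nat.mul_le_mul_left 2 ?_)
  refine Finset.card_le_card_of_injOn (fun c => c - I) ?_ ?_
  · intro c hc
    simp only [Finset.coe_filter, Finset.mem_Ioc, Set.mem_ofPred_eq, Finset.mem_Icc] at hc ⊢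
    refine ⟨by omega, ?_⟩
    rw [Nat.add_sub_cancel' hc.1.1.le]; exact hc.2
  · intro c hc c' hc' h
    simp only [Finset.coe_filter, Finset.mem_Ioc, Set.mem_ofPred_eq] at hc hc' h
    omega

lemma accProb_searchLeft_le {I : ℕ} (h : p.LeftGood α y I) (hn : 3 ≤ ⌈20 * Real.log n⌉₊) :
    accProb (p.searchLeft α y I) ≤ 1 / 2 := by
  obtain ⟨i, hi, hiI, hc⟩ := h
  rw [searchLeft, accProb_loop_const]
  refine (pow_le_pow_left₀ (accProb_nonneg _) ?_ _).trans (three_quarters_pow_le_half hn)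
  refine accProb_dyadic_loop_le (d := I - i) (by omega) (by omega)
    (fun J => p.localTest α y (I - J) I)
    (V := (Finset.Icc 1 (I - i)).filter fun J => p.localTest α y (I - J) I = true)
    (Finset.filter_subset _ _) ?_ (fun J hJ => (Finset.mem_filter.mp hJ).2)
  refine hc.trans (Nat.mul_le_mul_left 2 ?_)
  refine Finset.card_le_card_of_injOn (fun c => I - c) ?_ ?_
  · intro c hc
    simp only [Finset.coe_filter, Finset.mem_Ico, Set.mem_ofPred_eq, Finset.mem_Icc] at hc ⊢
    refine ⟨by omega, ?_⟩
    rw [Nat.sub_sub_self hc.1.2.le]; exact hc.2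
  · intro c hc c' hc' h
    simp only [Finset.coe_filter, Finset.mem_Ico, Set.mem_ofPred_eq] at hc hc' h
    omega

/-- If a proportion `h` of the indices is good, `⌈2 log (2/α) / h⌉` rounds of the search all
accept with probability at most `(1 - h/2) ^ (2 log (2/α) / h) ≤ α / 2`. -/
lemma accProb_fomt_le (hα : 0 < α) (hn1 : 1 ≤ n) (hn : 3 ≤ ⌈20 * Real.log n⌉₊)
    (hh : 0 < p.bandwidth n) {V : Finset ℕ} (hV : V ⊆ Finset.Icc 1 n)
    (hcard : p.bandwidth n * n ≤ V.card)
    (hgood : ∀ I ∈ V, p.RightGood α y I ∨ p.LeftGood α y I) :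
    accProb (p.fomt α n y) ≤ α / 2 := by
  set h := p.bandwidth n with hdef
  have hn0 : (0 : ℝ) < n := by exact_mod_cast hn1
  rw [fomt, accProb_loop_const]
  have hle : accProb ((unif n).bind fun I =>
      orElse (if I + 1 ≤ n then p.searchRight α y I else PMF.pure false)
        (if 2 ≤ I then p.searchLeft α y I else PMF.pure false)) ≤ Real.exp (-(h / 2)) := by
    refine (accProb_unif_bind_le hn1 _ hV (ε := 1 / 2) fun I hI => ?_).trans ?_
    · rw [accProb_orElse]
      rcases hgood I hI with hg | hg
      · refine (mul_le_of_le_one_right (accProb_nonneg _) (accProb_le_one _)).trans ?_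
        obtain ⟨j, h1, h2, -⟩ := id hg
        rw [if_pos (by omega)]
        exact accProb_searchRight_le hg hn
      · refine (mul_le_of_le_one_left (accProb_nonneg _) (accProb_le_one _)).trans ?_
        obtain ⟨i, h1, h2, -⟩ := id hg
        rw [if_pos (by omega)]
        exact accProb_searchLeft_le hg hn
    · have h1 : h ≤ V.card / n := by rwa [le_div_iff₀ hn0]
      have h2 := Real.add_one_le_exp (-(h / 2))
      linarith
  refine (pow_le_pow_left₀ (accProb_nonneg _) hle _).trans ?_
  rw [← Real.exp_nat_mul]
  have hceil : p.Cn α n ≤ ⌈p.Cn α n⌉₊ := Nat.le_ceil _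
  have hC : p.Cn α n * (h / 2) = -Real.log (α / 2) := by
    rw [Cn, ← hdef]; field_simp
  have h3 : (⌈p.Cn α n⌉₊ : ℝ) * (-(h / 2)) ≤ Real.log (α / 2) := by
    have := mul_le_mul_of_nonneg_right hceil (by positivity : 0 ≤ h / 2)
    linarith
  calc _ ≤ Real.exp (Real.log (α / 2)) := Real.exp_le_exp.mpr h3
    _ = α / 2 := Real.exp_log (by positivity)

/-- The midpoint dichotomy. If every pair whose values of `F` drop by `δ / 2` is rejected, and
`F` drops by `δ` from every index of `A` to every index of `B`, then all of `A` or all of `B`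
is good: an index `c` between `i` and `j` violates monotonicity with `i` or with `j`. -/
lemma good_of_windows {F : ℕ → ℝ} {δ : ℝ} {A B : Finset ℕ} (hA : A ⊆ Finset.Icc 1 n)
    (hB : B ⊆ Finset.Icc 1 n) (hδ : 0 < δ)
    (htest : ∀ i j, 1 ≤ i → i < j → j ≤ n → δ / 2 ≤ F i - F j → p.localTest α y i j = true)
    (hdrop : ∀ i ∈ A, ∀ j ∈ B, i < j ∧ δ ≤ F i - F j) :
    (∀ I ∈ A, p.RightGood α y I) ∨ (∀ I ∈ B, p.LeftGood α y I) := by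
  classical
  by_contra! hcon
  obtain ⟨⟨i, hiA, hi⟩, ⟨j, hjB, hj⟩⟩ := hcon
  obtain ⟨hij, hd⟩ := hdrop i hiA j hjB
  have hi1 := (Finset.mem_Icc.mp (hA hiA)).1
  have hjn := (Finset.mem_Icc.mp (hB hjB)).2
  have hR : ¬ (j - i ≤ 2 * ((Finset.Ioc i j).filter fun c => p.localTest α y i c = true).card) :=
    fun h => hi ⟨j, hjn, hij, h⟩
  have hL : ¬ (j - i ≤ 2 * ((Finset.Ico i j).filter fun c => p.localTest α y c j = true).card) :=
    fun h => hj ⟨i, hi1, hij, h⟩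
  set R := (Finset.Ioc i j).filter fun c => p.localTest α y i c = true
  set S := (Finset.Ico i j).filter fun c => p.localTest α y c j = true
  have hcov : Finset.Ioo i j ⊆ (R.erase j) ∪ (S.erase i) := by
    intro c hc
    obtain ⟨h1, h2⟩ := Finset.mem_Ioo.mp hc
    rw [Finset.mem_union, Finset.mem_erase, Finset.mem_erase]
    rcases le_total (δ / 2) (F i - F c) with h | h
    · exact Or.inl ⟨h2.ne, Finset.mem_filter.mpr ⟨Finset.mem_Ioc.mpr ⟨h1, h2.le⟩,
        htest i c hi1 h1 (by omega) h⟩⟩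
    · exact Or.inr ⟨h1.ne', Finset.mem_filter.mpr ⟨Finset.mem_Ico.mpr ⟨h1.le, h2⟩,
        htest c j (by omega) h2 hjn (by linarith)⟩⟩
  have hij' : p.localTest α y i j = true := htest i j hi1 hij hjn (by linarith)
  have hjR : j ∈ R := Finset.mem_filter.mpr ⟨Finset.mem_Ioc.mpr ⟨hij, le_rfl⟩, hij'⟩
  have hiS : i ∈ S := Finset.mem_filter.mpr ⟨Finset.mem_Ico.mpr ⟨le_rfl, hij⟩, hij'⟩
  have h1 := (Finset.card_le_card hcov).trans (Finset.card_union_le _ _)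
  rw [Nat.card_Ioo, Finset.card_erase_of_mem hjR, Finset.card_erase_of_mem hiS] at h1
  have := Finset.card_pos.mpr ⟨j, hjR⟩
  have := Finset.card_pos.mpr ⟨i, hiS⟩
  omega

end Params

end FOMT

/-! ### Hölder classes of smoothness at most two -/

namespace FOMT

lemma natCeil_of_le_one {β : ℝ} (h0 : 0 < β) (h1 : β ≤ 1) : ⌈β⌉₊ = 1 :=
  (Nat.ceil_eq_iff one_ne_zero).mpr (by simpa using ⟨h0, h1⟩)

lemma natCeil_of_one_lt {β : ℝ} (h1 : 1 < β) (h2 : β ≤ 2) : ⌈β⌉₊ = 2 :=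
  (Nat.ceil_eq_iff two_ne_zero).mpr (by norm_num; exact ⟨h1, h2⟩)

lemma order_of_le_one {β : ℝ} (h0 : 0 < β) (h1 : β ≤ 1) : order β = 0 := by
  rw [order, natCeil_of_le_one h0 h1]

lemma order_of_one_lt {β : ℝ} (h1 : 1 < β) (h2 : β ≤ 2) : order β = 1 := by
  rw [order, natCeil_of_one_lt h1 h2]

lemma mem_holderClass_of_le_one {β L : ℝ} (h0 : 0 < β) (h1 : β ≤ 1) {f : ℝ → ℝ} :
    f ∈ holderClass β L ↔ ContinuousOn f (Icc 0 1) ∧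
      ∀ x ∈ Icc (0 : ℝ) 1, ∀ y ∈ Icc (0 : ℝ) 1, |f x - f y| ≤ L * |x - y| ^ β := by
  simp [holderClass, order_of_le_one h0 h1, natCeil_of_le_one h0 h1]

lemma mem_holderClass_of_one_lt {β L : ℝ} (h1 : 1 < β) (h2 : β ≤ 2) {f : ℝ → ℝ} :
    f ∈ holderClass β L ↔ ContDiffOn ℝ 1 f (Icc 0 1) ∧
      ∀ x ∈ Icc (0 : ℝ) 1, ∀ y ∈ Icc (0 : ℝ) 1,
        |derivWithin f (Icc 0 1) x - derivWithin f (Icc 0 1) y| ≤ L * |x - y| ^ (β - 1) := by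
  have e : β + 1 - (2 : ℝ) = β - 1 := by ring
  simp [holderClass, order_of_one_lt h1 h2, natCeil_of_one_lt h1 h2, iteratedDerivWithin_one, e]

lemma hasDerivWithinAt_of_contDiffOn {f : ℝ → ℝ} (hf : ContDiffOn ℝ 1 f (Icc 0 1)) {x : ℝ}
    (hx : x ∈ Icc (0 : ℝ) 1) :
    HasDerivWithinAt f (derivWithin f (Icc 0 1) x) (Icc 0 1) x :=
  ((hf.differentiableOn one_ne_zero) x hx).hasDerivWithinAt

lemma dotProduct_polyVec_zero {k : ℕ} (θ : Fin (k + 1) → ℝ) :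
    dotProduct θ (polyVec k 0) = θ 0 := by
  rw [dotProduct, Fin.sum_univ_succ]
  simp [polyVec]

/-- The Taylor polynomial of order `⌈β⌉ - 1`, in the coordinates of the local polynomial
estimator, approximates a function of `Σ(β, L)` up to `L |z - x| ^ β`. -/
lemma exists_taylor_coeff {β L : ℝ} (h0 : 0 < β) (h2 : β ≤ 2) {f : ℝ → ℝ}
    (hf : f ∈ holderClass β L) {h : ℝ} (hh : 0 < h) {x : ℝ} (hx : x ∈ Icc (0 : ℝ) 1) :
    ∃ θ : Fin (order β + 1) → ℝ, θ 0 = f x ∧ ∀ z ∈ Icc (0 : ℝ) 1,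
      |f z - dotProduct θ (polyVec (order β) ((z - x) / h))| ≤ L * |z - x| ^ β := by
  rcases le_or_gt β 1 with h1 | h1
  · rw [mem_holderClass_of_le_one h0 h1] at hf
    rw [order_of_le_one h0 h1]
    refine ⟨fun _ => f x, rfl, fun z hz => ?_⟩
    simpa [dotProduct, polyVec] using hf.2 z hz x hx
  · rw [mem_holderClass_of_one_lt h1 h2] at hf
    rw [order_of_one_lt h1 h2]
    set D := derivWithin f (Icc 0 1) with hD
    refine ⟨![f x, h * D x], rfl, fun z hz => ?_⟩
    have hL : 0 ≤ L := by
      have := (abs_nonneg _).trans (hf.2 0 (by simp) 1 (by simp))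
      simpa using this
    have hsub : uIcc x z ⊆ Icc (0 : ℝ) 1 := uIcc_subset_Icc hx hz
    have key := Convex.norm_image_sub_le_of_norm_hasDerivWithin_le
      (f := fun t => f t - D x * t) (f' := fun t => D t - D x) (s := uIcc x z)
      (C := L * |z - x| ^ (β - 1)) (x := x) (y := z)
      (fun t ht => by
        have h3 := (hasDerivWithinAt_of_contDiffOn hf.1 (hsub ht)).mono hsub
        have h4 : HasDerivWithinAt (fun t => D x * t) (D x) (uIcc x z) t := by
          simpa using (hasDerivWithinAt_id t (uIcc x z)).const_mul (D x)
        exact h3.sub h4)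
      (fun t ht => by
        refine (hf.2 t (hsub ht) x hx).trans ?_
        refine mul_le_mul_of_nonneg_left ?_ hL
        refine Real.rpow_le_rpow (abs_nonneg _) ?_ (by linarith)
        exact abs_sub_left_of_mem_uIcc ht)
      (convex_uIcc x z) left_mem_uIcc right_mem_uIcc
    simp only [Real.norm_eq_abs] at key
    have e1 : f z - D x * z - (f x - D x * x)
        = f z - dotProduct ![f x, h * D x] (polyVec 1 ((z - x) / h)) := by
      simp [dotProduct, polyVec, Fin.sum_univ_two]
      field_simp
      ring
    rw [e1] at key
    refine key.trans (le_of_eq ?_)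
    rw [mul_assoc]
    congr 1
    rcases eq_or_ne (|z - x|) 0 with h5 | h5
    · rw [h5, mul_zero, Real.zero_rpow h0.ne']
    · rw [← Real.rpow_add_one h5]; congr 1; ring

/-! ### Counting design points -/

/-- An interval of radius `r` contains at most `2 n r + 1` design points. -/
lemma card_design_le (n : ℕ) (x : ℝ) {r : ℝ} (hr : 0 ≤ r) :
    ((Finset.univ.filter fun l : Fin n => |design n (l + 1) - x| ≤ r).card : ℝ)
      ≤ 2 * n * r + 1 := by
  rcases Nat.eq_zero_or_pos n with rfl | hn
  · simp
  have hn0 : (0 : ℝ) < n := by exact_mod_cast hn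
  have h1 : (Finset.univ.filter fun l : Fin n => |design n (l + 1) - x| ≤ r).card
      ≤ (Finset.Icc ⌈n * (x - r)⌉ ⌊n * (x + r)⌋).card := by
    refine Finset.card_le_card_of_injOn (fun l : Fin n => ((l : ℕ) : ℤ) + 1) ?_ ?_
    · intro l hl
      simp only [Finset.coe_filter, Finset.mem_univ, true_and, Set.mem_ofPred_eq, design,
        abs_le] at hl
      have e : (((l : ℕ) + 1 : ℕ) : ℝ) = n * ((((l : ℕ) + 1 : ℕ) : ℝ) / n) := by field_simp
      have e2 : ((((l : ℕ) : ℤ) + 1 : ℤ) : ℝ) = (((l : ℕ) + 1 : ℕ) : ℝ) := by push_cast; ring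
      rw [Finset.coe_Icc, Set.mem_Icc, Int.ceil_le, Int.le_floor, e2, e]
      exact ⟨mul_le_mul_of_nonneg_left (by linarith [hl.1]) hn0.le,
        mul_le_mul_of_nonneg_left (by linarith [hl.2]) hn0.le⟩
    · intro a _ b _ hab
      have : (a : ℕ) = b := by simpa using hab
      exact Fin.ext this
  have h2 : ((Finset.Icc ⌈n * (x - r)⌉ ⌊n * (x + r)⌋).card : ℝ) ≤ 2 * n * r + 1 := by
    rw [Int.card_Icc]
    have h3 := Int.floor_le (n * (x + r))
    have h4 := Int.le_ceil (n * (x - r))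
    have h5 : (0 : ℝ) ≤ 2 * n * r + 1 := by positivity
    rcases le_total 0 (⌊n * (x + r)⌋ + 1 - ⌈n * (x - r)⌉) with h | h
    · have : (((⌊n * (x + r)⌋ + 1 - ⌈n * (x - r)⌉).toNat : ℤ) : ℝ)
          = ((⌊n * (x + r)⌋ + 1 - ⌈n * (x - r)⌉ : ℤ) : ℝ) := by rw [Int.toNat_of_nonneg h]
      rw [Int.cast_natCast] at this
      rw [this]
      push_cast
      nlinarith
    · rw [Int.toNat_of_nonpos h]; simpa using h5
  exact (by exact_mod_cast h1 : _ ≤ _).trans h2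

open Classical in
/-- The indices of the design points in `[u, v]`. -/
noncomputable def designIn (n : ℕ) (u v : ℝ) : Finset ℕ :=
  (Finset.Icc 1 n).filter fun i => design n i ∈ Icc u v

lemma le_card_designIn {n : ℕ} (hn : 1 ≤ n) {u w : ℝ} (hu : 0 ≤ u) (hw : u + w ≤ 1) (hw0 : 0 ≤ w) :
    w * n - 1 ≤ ((designIn n u (u + w)).card : ℝ) := by
  have hn0 : (0 : ℝ) < n := by exact_mod_cast hn
  have h1 : (Finset.Ioc ⌊u * n⌋₊ ⌊(u + w) * n⌋₊).card ≤ (designIn n u (u + w)).card := by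
    refine Finset.card_le_card fun i hi => ?_
    obtain ⟨h2, h3⟩ := Finset.mem_Ioc.mp hi
    have h4 : u * n < i := (Nat.floor_lt (by positivity)).mp h2
    have h5 : (i : ℝ) ≤ (u + w) * n := (Nat.le_floor_iff (by positivity)).mp h3
    have h6 : (i : ℝ) ≤ n := h5.trans (by nlinarith)
    refine Finset.mem_filter.mpr ⟨Finset.mem_Icc.mpr ⟨by omega, by exact_mod_cast h6⟩, ?_⟩
    rw [design]
    exact ⟨by rw [le_div_iff₀ hn0]; exact h4.le, by rw [div_le_iff₀ hn0]; exact h5⟩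
  rw [Nat.card_Ioc] at h1
  have h7 : ((⌊(u + w) * n⌋₊ : ℝ)) ≤ ((designIn n u (u + w)).card : ℝ) + ⌊u * n⌋₊ := by
    have : ⌊(u + w) * n⌋₊ ≤ (designIn n u (u + w)).card + ⌊u * n⌋₊ := by omega
    exact_mod_cast this
  have h8 := Nat.floor_le (by positivity : 0 ≤ u * n)
  have h9 := Nat.lt_floor_add_one ((u + w) * (n : ℝ))
  linarith

lemma design_mem_Icc {n i : ℕ} (hi : i ≤ n) : design n i ∈ Icc (0 : ℝ) 1 := by
  rw [design]
  refine ⟨by positivity, div_le_one_of_le₀ (by exact_mod_cast hi) (by positivity)⟩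

lemma sum_fin_eq_sum_Icc (n : ℕ) (F : ℕ → ℝ) :
    ∑ l : Fin n, F (l + 1) = ∑ l ∈ Finset.Icc 1 n, F l := by
  rw [Fin.sum_univ_eq_sum_range (fun l => F (l + 1)) n, Finset.range_eq_Ico,
    Finset.sum_Ico_add' F 0 n 1]
  rfl

/-! ### Local polynomial estimation -/

/-- Two evaluations of `a + b u` at distance at least `d` control both coefficients. -/
lemma sq_add_sq_le_of_two_points {a b u u' d : ℝ} (hu : |u| ≤ 1) (hd : 0 < d) (hd1 : d ≤ 1)
    (huu : d ≤ |u' - u|) :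
    d ^ 2 / 8 * (a ^ 2 + b ^ 2) ≤ (a + b * u) ^ 2 + (a + b * u') ^ 2 := by
  set A := (a + b * u) ^ 2 + (a + b * u') ^ 2 with hA
  have h1 : d ^ 2 ≤ (u' - u) ^ 2 := by
    rw [← sq_abs (u' - u)]; exact pow_le_pow_left₀ hd.le huu 2
  have h2 : b ^ 2 * d ^ 2 ≤ 2 * A := by
    have : b ^ 2 * d ^ 2 ≤ b ^ 2 * (u' - u) ^ 2 := mul_le_mul_of_nonneg_left h1 (sq_nonneg b)
    have h3 : b ^ 2 * (u' - u) ^ 2 = ((a + b * u') - (a + b * u)) ^ 2 := by ring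
    nlinarith [sq_nonneg ((a + b * u') + (a + b * u))]
  have hu2 : u ^ 2 ≤ 1 := by rw [← sq_abs]; exact pow_le_one₀ (abs_nonneg _) hu
  have h4 : a ^ 2 ≤ 2 * A + 2 * b ^ 2 := by
    have h5 : b ^ 2 * u ^ 2 ≤ b ^ 2 * 1 := mul_le_mul_of_nonneg_left hu2 (sq_nonneg b)
    nlinarith [sq_nonneg (a + 2 * (b * u)), sq_nonneg (a + b * u')]
  have hd2 : d ^ 2 ≤ 1 := pow_le_one₀ hd.le hd1
  have hA0 : 0 ≤ A := by positivity
  nlinarith [mul_le_mul_of_nonneg_left h4 (sq_nonneg d), mul_le_mul_of_nonneg_left hd2 hA0]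

/-- The design matrices of the local linear fit at the design points are uniformly positive
definite. At least one of the two neighbouring blocks of `2 N` design points, with
`N` of order `δ n h`, lies in the sample, and the points in it are paired at distance `N`. -/
lemma le_sum_kernel_mul_sq {K : ℝ → ℝ} (hK : ∀ u, 0 ≤ K u) {Kmin δ : ℝ} (hKmin : 0 < Kmin)
    (hδ : 0 < δ) (hδ1 : δ ≤ 1) (hKδ : ∀ u, |u| ≤ δ → Kmin ≤ K u) {n i : ℕ} (hi : 1 ≤ i)
    (hin : i ≤ n) {h : ℝ} (hh : 0 < h) (hh1 : 2 * h ≤ 1) (hnh : 4 ≤ δ * (n * h)) (a b : ℝ) :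
    Kmin * δ ^ 3 / 512 * (n * h) * (a ^ 2 + b ^ 2) ≤
      ∑ l : Fin n, K ((design n (l + 1) - design n i) / h)
        * (a + b * ((design n (l + 1) - design n i) / h)) ^ 2 := by
  have hn0 : (0 : ℝ) < n := by
    by_contra hcon
    have : (n : ℝ) = 0 := le_antisymm (not_lt.mp hcon) (by positivity)
    rw [this] at hnh; norm_num at hnh
  have hnh0 : (0 : ℝ) < n * h := by positivity
  set N : ℕ := ⌊δ * (n * h) / 2⌋₊ with hN
  have hN1 : (N : ℝ) ≤ δ * (n * h) / 2 := Nat.floor_le (by positivity)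
  have hN2 : δ * (n * h) / 4 ≤ N := by
    have := Nat.lt_floor_add_one (δ * (n * h) / 2)
    rw [← hN] at this; linarith
  have h4N : 4 * N ≤ n := by
    have : (4 * N : ℝ) ≤ n := by
      have : δ * (n * h) ≤ 1 * (n * h) := mul_le_mul_of_nonneg_right hδ1 hnh0.le
      nlinarith
    exact_mod_cast this
  set F : ℕ → ℝ := fun l => K ((design n l - design n i) / h)
        * (a + b * ((design n l - design n i) / h)) ^ 2 with hF
  have hF0 : ∀ l, 0 ≤ F l := fun l => mul_nonneg (hK _) (sq_nonneg _)
  rw [sum_fin_eq_sum_Icc n F]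
  -- `e m` runs through `2 N` consecutive indices, to the right or to the left of `i`.
  obtain ⟨e, s, hs, hemem, heinj, he⟩ : ∃ (e : ℕ → ℕ) (s : ℝ), |s| = 1 ∧
      (∀ m < 2 * N, e m ∈ Finset.Icc 1 n) ∧
      (∀ m < 2 * N, ∀ m' < 2 * N, e m = e m' → m = m') ∧
      (∀ m < 2 * N, (e m : ℝ) - i = s * m) := by
    rcases le_or_gt (i + 2 * N) n with h1 | h1
    · refine ⟨fun m => i + m, 1, by simp, fun m hm => Finset.mem_Icc.mpr ⟨by dsimp only; omega, by dsimp only; omega⟩,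
        fun m _ m' _ h => by simpa using h, fun m _ => by push_cast; ring⟩
    · refine ⟨fun m => i - m, -1, by simp,
        fun m hm => Finset.mem_Icc.mpr ⟨by dsimp only; omega, by dsimp only; omega⟩,
        fun m _ m' _ h => by simp only at h; omega, fun m hm => ?_⟩
      simp only
      rw [Nat.cast_sub (by omega)]; ring
  have hu : ∀ m < 2 * N, (design n (e m) - design n i) / h = s * (m / (n * h)) := by
    intro m hm
    rw [design, design, ← sub_div, he m hm]; field_simp
  have hsub : ∑ m ∈ Finset.range (N + N), F (e m) ≤ ∑ l ∈ Finset.Icc 1 n, F l := by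
    rw [← Finset.sum_image (f := F) (g := e) (s := Finset.range (N + N))]
    · refine Finset.sum_le_sum_of_subset_of_nonneg ?_ (fun l _ _ => hF0 l)
      intro l hl
      obtain ⟨m, hm, rfl⟩ := Finset.mem_image.mp hl
      exact hemem m (by rw [Finset.mem_range] at hm; omega)
    · intro m hm m' hm'
      simp only [Finset.coe_range, Set.mem_Iio] at hm hm'
      exact heinj m (by omega) m' (by omega)
  refine le_trans ?_ hsub
  rw [Finset.sum_range_add, ← Finset.sum_add_distrib]
  have hterm : ∀ m ∈ Finset.range N,
      Kmin * ((δ / 4) ^ 2 / 8 * (a ^ 2 + b ^ 2)) ≤ F (e m) + F (e (N + m)) := by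
    intro m hm
    rw [Finset.mem_range] at hm
    have habs : ∀ m < 2 * N, |s * ((m : ℝ) / (n * h))| ≤ δ := by
      intro m hm
      rw [abs_mul, hs, one_mul, abs_of_nonneg (by positivity), div_le_iff₀ hnh0]
      have : (m : ℝ) ≤ 2 * N := by exact_mod_cast hm.le
      linarith
    have hm1 : m < 2 * N := by omega
    have hm2 : N + m < 2 * N := by omega
    simp only [hF]
    rw [hu m hm1, hu (N + m) hm2]
    have hk1 := hKδ _ (habs m hm1)
    have hk2 := hKδ _ (habs (N + m) hm2)
    have hpt := sq_add_sq_le_of_two_points (a := a) (b := b) (d := δ / 4)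
      ((habs m hm1).trans hδ1) (by positivity) (by linarith)
      (u' := s * (((N + m : ℕ) : ℝ) / (n * h))) (by
        rw [← mul_sub, abs_mul, hs, one_mul, ← sub_div]
        push_cast
        rw [add_sub_cancel_right, abs_of_nonneg (by positivity), le_div_iff₀ hnh0]
        linarith)
    refine (mul_le_mul_of_nonneg_left hpt hKmin.le).trans ?_
    rw [mul_add]
    exact add_le_add (mul_le_mul_of_nonneg_right hk1 (sq_nonneg _))
      (mul_le_mul_of_nonneg_right hk2 (sq_nonneg _))
  refine le_trans ?_ (Finset.sum_le_sum hterm)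
  rw [Finset.sum_const, Finset.card_range, nsmul_eq_mul]
  have : Kmin * δ ^ 3 / 512 * (n * h) * (a ^ 2 + b ^ 2)
      = δ * (n * h) / 4 * (Kmin * ((δ / 4) ^ 2 / 8 * (a ^ 2 + b ^ 2))) := by ring
  rw [this]
  exact mul_le_mul_of_nonneg_right hN2 (by positivity)

lemma exists_coeff_of_order_le_one {k : ℕ} (hk : k ≤ 1) (θ : Fin (k + 1) → ℝ) :
    ∃ b : ℝ, (∀ u, dotProduct θ (polyVec k u) = θ 0 + b * u) ∧
      ∑ m, θ m ^ 2 = θ 0 ^ 2 + b ^ 2 := by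
  obtain rfl | rfl : k = 0 ∨ k = 1 := by omega
  · exact ⟨0, fun u => by simp [dotProduct, polyVec], by simp⟩
  · exact ⟨θ 1, fun u => by simp [dotProduct, polyVec, Fin.sum_univ_two],
      by simp [Fin.sum_univ_two]⟩

lemma sq_norm_le_sum_sq {ι : Type*} [Fintype ι] (θ : ι → ℝ) : ‖θ‖ ^ 2 ≤ ∑ m, θ m ^ 2 := by
  have h : ‖θ‖ ≤ √(∑ m, θ m ^ 2) := by
    refine (pi_norm_le_iff_of_nonneg (Real.sqrt_nonneg _)).mpr fun m => ?_
    rw [Real.norm_eq_abs]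
    refine Real.abs_le_sqrt ?_
    exact Finset.single_le_sum (f := fun m => θ m ^ 2) (fun i _ => sq_nonneg _) (Finset.mem_univ m)
  calc ‖θ‖ ^ 2 ≤ √(∑ m, θ m ^ 2) ^ 2 := pow_le_pow_left₀ (norm_nonneg _) h 2
    _ = _ := Real.sq_sqrt (Finset.sum_nonneg fun i _ => sq_nonneg _)

section Estimator

variable {K : ℝ → ℝ} {h : ℝ} {k n : ℕ} {x : ℝ} {κ : ℝ}

/-- The weighted sum of squares has a minimizer when its quadratic form is positive definite. -/
lemma lpeCoeff_isMin (hK : ∀ u, 0 ≤ K u) (hκ : 0 < κ)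
    (hcoer : ∀ θ : Fin (k + 1) → ℝ, κ * ∑ m, θ m ^ 2 ≤
      ∑ l : Fin n, K ((design n (l + 1) - x) / h)
        * dotProduct θ (polyVec k ((design n (l + 1) - x) / h)) ^ 2)
    (y : Fin n → ℝ) (θ' : Fin (k + 1) → ℝ) :
    lpeObjective K h k y x (lpeCoeff K h k y x) ≤ lpeObjective K h k y x θ' := by
  have hex : ∃ θ : Fin (k + 1) → ℝ, ∀ θ', lpeObjective K h k y x θ ≤ lpeObjective K h k y x θ' := by
    refine Continuous.exists_forall_le (f := lpeObjective K h k y x) ?_ ?_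
    · unfold lpeObjective dotProduct
      fun_prop
    · set c := ∑ l : Fin n, y l ^ 2 * K ((design n (l + 1) - x) / h) with hc
      have hlow : ∀ θ, κ / 2 * ‖θ‖ ^ 2 + -c ≤ lpeObjective K h k y x θ := by
        intro θ
        have h1 := hcoer θ
        have h2 := mul_le_mul_of_nonneg_left (sq_norm_le_sum_sq θ) hκ.le
        have h3 : (∑ l : Fin n, K ((design n (l + 1) - x) / h)
            * dotProduct θ (polyVec k ((design n (l + 1) - x) / h)) ^ 2) / 2 - c
            ≤ lpeObjective K h k y x θ := by
          rw [hc, lpeObjective, Finset.sum_div, ← Finset.sum_sub_distrib]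
          refine Finset.sum_le_sum fun l _ => ?_
          have := hK ((design n (l + 1) - x) / h)
          set w := K ((design n (l + 1) - x) / h)
          set g := dotProduct θ (polyVec k ((design n (l + 1) - x) / h))
          nlinarith [mul_nonneg this (sq_nonneg (2 * y l - g))]
        linarith
      refine tendsto_atTop_mono hlow (tendsto_atTop_add_const_right _ _ ?_)
      exact ((tendsto_pow_atTop two_ne_zero).comp
        (tendsto_norm_cocompact_atTop (E := Fin (k + 1) → ℝ))).const_mul_atTop (by positivity)
  exact Classical.epsilon_spec hex θ'

/-- The basic inequality for least squares: comparing the minimizer with `θ₀`, the quadratic form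
of the error is dominated by its pairing with the weighted moments of the residuals at `θ₀`, so
that moments of size `κ τ` force an error of at most `3 τ`. -/
lemma abs_lpe_sub_le (hK : ∀ u, 0 ≤ K u) (hκ : 0 < κ) (hk : k ≤ 1)
    (hcoer : ∀ θ : Fin (k + 1) → ℝ, κ * ∑ m, θ m ^ 2 ≤
      ∑ l : Fin n, K ((design n (l + 1) - x) / h)
        * dotProduct θ (polyVec k ((design n (l + 1) - x) / h)) ^ 2)
    (y : Fin n → ℝ) (θ₀ : Fin (k + 1) → ℝ) {τ : ℝ} (hτ : 0 ≤ τ)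
    (hT : ∀ m : Fin (k + 1), |∑ l : Fin n, K ((design n (l + 1) - x) / h)
      * (y l - dotProduct θ₀ (polyVec k ((design n (l + 1) - x) / h)))
      * polyVec k ((design n (l + 1) - x) / h) m| ≤ κ * τ) :
    |lpe K h k y x - θ₀ 0| ≤ 3 * τ := by
  set U : Fin n → Fin (k + 1) → ℝ := fun l => polyVec k ((design n (l + 1) - x) / h) with hU
  set w : Fin n → ℝ := fun l => K ((design n (l + 1) - x) / h) with hw
  set θ := lpeCoeff K h k y x with hθ
  set T : Fin (k + 1) → ℝ := fun m => ∑ l, w l * (y l - dotProduct θ₀ (U l)) * U l m with hTdef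
  have hmin := lpeCoeff_isMin hK hκ hcoer y θ₀
  have hc := hcoer (θ - θ₀)
  have hpair : ∑ m, (θ - θ₀) m * T m
      = ∑ l, w l * (y l - dotProduct θ₀ (U l)) * dotProduct (θ - θ₀) (U l) := by
    simp only [hTdef, dotProduct, Finset.mul_sum]
    rw [Finset.sum_comm]
    exact Finset.sum_congr rfl fun l _ => Finset.sum_congr rfl fun m _ => by ring
  have hexp : lpeObjective K h k y x θ = lpeObjective K h k y x θ₀
      - 2 * ∑ m, (θ - θ₀) m * T m + ∑ l, w l * dotProduct (θ - θ₀) (U l) ^ 2 := by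
    rw [hpair, lpeObjective, lpeObjective, Finset.mul_sum, ← Finset.sum_sub_distrib,
      ← Finset.sum_add_distrib]
    refine Finset.sum_congr rfl fun l _ => ?_
    rw [sub_dotProduct]
    simp only [hU, hw]
    ring
  have hS : κ * ∑ m, (θ - θ₀) m ^ 2 ≤ 2 * ∑ m, (θ - θ₀) m * T m := by
    have : ∑ l, w l * dotProduct (θ - θ₀) (U l) ^ 2 ≤ 2 * ∑ m, (θ - θ₀) m * T m := by
      linarith
    exact hc.trans this
  have hb : 2 * ∑ m, (θ - θ₀) m * T m ≤ κ / 2 * ∑ m, (θ - θ₀) m ^ 2 + 4 * κ * τ ^ 2 := by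
    have h1 : ∀ m, 2 * ((θ - θ₀) m * T m) ≤ κ / 2 * (θ - θ₀) m ^ 2 + 2 * κ * τ ^ 2 := by
      intro m
      have h2 : (θ - θ₀) m * T m ≤ |(θ - θ₀) m| * (κ * τ) := by
        refine (le_abs_self _).trans ?_
        rw [abs_mul]
        exact mul_le_mul_of_nonneg_left (hT m) (abs_nonneg _)
      have h3 : 0 ≤ κ / 2 * (|(θ - θ₀) m| - 2 * τ) ^ 2 := by positivity
      have h4 := sq_abs ((θ - θ₀) m)
      nlinarith
    rw [Finset.mul_sum, Finset.mul_sum]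
    refine (Finset.sum_le_sum fun m _ => h1 m).trans ?_
    rw [Finset.sum_add_distrib]
    simp only [Finset.sum_const, Finset.card_univ, Fintype.card_fin, nsmul_eq_mul]
    have hk2 : ((k + 1 : ℕ) : ℝ) ≤ 2 := by exact_mod_cast (by omega : k + 1 ≤ 2)
    have : ((k + 1 : ℕ) : ℝ) * (2 * κ * τ ^ 2) ≤ 2 * (2 * κ * τ ^ 2) :=
      mul_le_mul_of_nonneg_right hk2 (by positivity)
    linarith
  have h8 : ∑ m, (θ - θ₀) m ^ 2 ≤ 8 * τ ^ 2 := by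
    have : κ * ∑ m, (θ - θ₀) m ^ 2 ≤ κ * (8 * τ ^ 2) := by linarith
    exact le_of_mul_le_mul_left this hκ
  have h0 : (θ 0 - θ₀ 0) ^ 2 ≤ (3 * τ) ^ 2 := by
    have := Finset.single_le_sum (f := fun m => (θ - θ₀) m ^ 2) (fun i _ => sq_nonneg _)
      (Finset.mem_univ (0 : Fin (k + 1)))
    simp only [Pi.sub_apply] at this h8
    nlinarith [sq_nonneg τ]
  rw [lpe, dotProduct_polyVec_zero]
  exact abs_le_of_sq_le_sq h0 (by positivity)

end Estimator

lemma abs_polyVec_le_one {k : ℕ} {u : ℝ} (hu : |u| ≤ 1) (m : Fin (k + 1)) :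
    |polyVec k u m| ≤ 1 := by
  rw [polyVec, abs_div, abs_pow, Nat.abs_cast]
  refine div_le_one_of_le₀ ((pow_le_one₀ (abs_nonneg _) hu).trans ?_) (by positivity)
  exact_mod_cast Nat.one_le_iff_ne_zero.mpr (Nat.factorial_ne_zero _)

/-- The part of the data that enters the `m`-th normal equation of the local fit at `x`, centred
at its mean under `P_f`. -/
noncomputable def noiseMoment (K : ℝ → ℝ) (h : ℝ) (k : ℕ) (f : ℝ → ℝ) {n : ℕ} (y : Fin n → ℝ)
    (x : ℝ) (m : Fin (k + 1)) : ℝ :=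
  ∑ l : Fin n, K ((design n (l + 1) - x) / h) * polyVec k ((design n (l + 1) - x) / h) m
    * (y l - f (design n (l + 1)))

/-- A kernel-weighted sum of bounded terms has at most `3 n h` nonzero terms. -/
lemma abs_sum_kernel_mul_le {K : ℝ → ℝ} (hK : ∀ u, 0 ≤ K u) (hsupp : ∀ u, 1 < |u| → K u = 0)
    {Kmax : ℝ} (hKmax : ∀ u, K u ≤ Kmax) {n : ℕ} {h : ℝ} (hh : 0 < h) (hnh : 1 ≤ n * h) (x : ℝ)
    (g : Fin n → ℝ) {B : ℝ} (hB : 0 ≤ B)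
    (hg : ∀ l : Fin n, |(design n (l + 1) - x) / h| ≤ 1 → |g l| ≤ B) :
    |∑ l : Fin n, K ((design n (l + 1) - x) / h) * g l| ≤ 3 * Kmax * B * (n * h) := by
  have hKm : 0 ≤ Kmax := (hK 0).trans (hKmax 0)
  refine (Finset.abs_sum_le_sum_abs _ _).trans ?_
  have h1 : ∀ l : Fin n, |K ((design n (l + 1) - x) / h) * g l|
      ≤ if |design n (l + 1) - x| ≤ h then Kmax * B else 0 := by
    intro l
    have e : |(design n (l + 1) - x) / h| = |design n (l + 1) - x| / h := by
      rw [abs_div, abs_of_pos hh]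
    split_ifs with hl
    · rw [abs_mul, abs_of_nonneg (hK _)]
      refine mul_le_mul (hKmax _) (hg l ?_) (abs_nonneg _) hKm
      rw [e]; exact div_le_one_of_le₀ hl hh.le
    · rw [hsupp _ (by rw [e, lt_div_iff₀ hh]; linarith), zero_mul, abs_zero]
  refine (Finset.sum_le_sum fun l _ => h1 l).trans ?_
  rw [← Finset.sum_filter, Finset.sum_const, nsmul_eq_mul]
  have h2 := card_design_le n x hh.le
  have h3 : ((Finset.univ.filter fun l : Fin n => |design n (l + 1) - x| ≤ h).card : ℝ)
      ≤ 3 * (n * h) := by linarith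
  calc _ ≤ 3 * (n * h) * (Kmax * B) := mul_le_mul_of_nonneg_right h3 (by positivity)
    _ = _ := by ring

/-- The error of the local polynomial estimator at the design points, once the noise moments
are controlled: the bias is of order `h ^ β`. -/
lemma abs_lpe_sub_le_of_noise {β L : ℝ} (hβ : 0 < β) (hβ2 : β ≤ 2) (hL : 0 ≤ L) {K : ℝ → ℝ}
    (hK : ∀ u, 0 ≤ K u) (hsupp : ∀ u, 1 < |u| → K u = 0) {Kmax : ℝ} (hKmax : ∀ u, K u ≤ Kmax)
    {Kmin δ : ℝ} (hKmin : 0 < Kmin) (hδ : 0 < δ) (hδ1 : δ ≤ 1)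
    (hKδ : ∀ u, |u| ≤ δ → Kmin ≤ K u) {f : ℝ → ℝ} (hf : f ∈ holderClass β L) {n i : ℕ}
    (hi : 1 ≤ i) (hin : i ≤ n) {h : ℝ} (hh : 0 < h) (hh1 : 2 * h ≤ 1) (hnh : 4 ≤ δ * (n * h))
    {M : ℝ} (hM : 0 ≤ M) (y : Fin n → ℝ)
    (hnoise : ∀ m, |noiseMoment K h (order β) f y (design n i) m| ≤ M * h ^ β * (n * h)) :
    |lpe K h (order β) y (design n i) - f (design n i)|
      ≤ 3 * ((3 * Kmax * L + M) / (Kmin * δ ^ 3 / 512)) * h ^ β := by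
  have hnh0 : (0 : ℝ) < n * h := by
    by_contra hcon
    have := mul_nonneg hδ.le (sub_nonneg.mpr (not_lt.mp hcon))
    linarith
  have hnh1 : (1 : ℝ) ≤ n * h := by
    have := mul_le_mul_of_nonneg_right hδ1 hnh0.le
    linarith
  have hKm : 0 ≤ Kmax := (hK 0).trans (hKmax 0)
  have hord : order β ≤ 1 := by
    rcases le_or_gt β 1 with h1 | h1
    · rw [order_of_le_one hβ h1]; omega
    · rw [order_of_one_lt h1 hβ2]
  have hhβ : 0 < h ^ β := Real.rpow_pos_of_pos hh β
  set x := design n i with hx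
  obtain ⟨θ₀, hθ₀, htay⟩ := exists_taylor_coeff hβ hβ2 hf hh (design_mem_Icc hin)
  rw [← hθ₀]
  set lam := Kmin * δ ^ 3 / 512 with hlam
  have hlam0 : 0 < lam := by positivity
  rw [mul_assoc]
  refine abs_lpe_sub_le (κ := lam * (n * h)) hK (by positivity) hord ?_ y θ₀ (by positivity) ?_
  · intro θ
    obtain ⟨b, hb, hsum⟩ := exists_coeff_of_order_le_one hord θ
    rw [hsum]
    simp only [hb]
    exact le_sum_kernel_mul_sq hK hKmin hδ hδ1 hKδ hi hin hh hh1 hnh _ _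
  · intro m
    have hsplit : ∑ l : Fin n, K ((design n (l + 1) - x) / h)
        * (y l - dotProduct θ₀ (polyVec (order β) ((design n (l + 1) - x) / h)))
        * polyVec (order β) ((design n (l + 1) - x) / h) m
        = noiseMoment K h (order β) f y x m + ∑ l : Fin n, K ((design n (l + 1) - x) / h)
          * ((f (design n (l + 1))
              - dotProduct θ₀ (polyVec (order β) ((design n (l + 1) - x) / h)))
            * polyVec (order β) ((design n (l + 1) - x) / h) m) := by
      rw [noiseMoment, ← Finset.sum_add_distrib]
      exact Finset.sum_congr rfl fun l _ => by ring
    rw [hsplit]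
    refine (abs_add_le _ _).trans ((add_le_add (hnoise m)
      (abs_sum_kernel_mul_le hK hsupp hKmax hh hnh1 x _ (B := L * h ^ β) (by positivity) ?_)).trans
      (le_of_eq ?_))
    · intro l hl
      rw [abs_mul]
      have h1 := htay (design n (l + 1)) (design_mem_Icc l.isLt)
      have h2 : |design n (l + 1) - x| ≤ h := by
        rwa [abs_div, abs_of_pos hh, div_le_one hh] at hl
      have h3 : L * |design n (l + 1) - x| ^ β ≤ L * h ^ β :=
        mul_le_mul_of_nonneg_left (Real.rpow_le_rpow (abs_nonneg _) h2 hβ.le) hL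
      calc _ ≤ (L * h ^ β) * 1 :=
            mul_le_mul (h1.trans h3) (abs_polyVec_le_one hl m) (abs_nonneg _) (by positivity)
        _ = _ := mul_one _
    · field_simp
      ring

end FOMT

/-! ### Concentration of the noise -/

namespace FOMT

instance isProbabilityMeasure_dataLaw (σ : ℝ) (n : ℕ) (f : ℝ → ℝ) :
    IsProbabilityMeasure (dataLaw σ n f) := by
  unfold dataLaw; infer_instance

lemma hasSubgaussianMGF_gaussianReal (v : ℝ≥0) :
    HasSubgaussianMGF id v (gaussianReal 0 v) where
  integrable_exp_mul t := integrable_exp_mul_gaussianReal t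
  mgf_le t := by rw [mgf_id_gaussianReal]; simp

lemma hasSubgaussianMGF_coord (σ : ℝ) {n : ℕ} (f : ℝ → ℝ) (c : ℝ) (l : Fin n) :
    HasSubgaussianMGF (fun y : Fin n → ℝ => c * (y l - f (design n (l + 1))))
      (Real.toNNReal (c ^ 2 * σ ^ 2)) (dataLaw σ n f) := by
  have h1 : HasSubgaussianMGF (fun z : ℝ => z - f (design n (l + 1))) (Real.toNNReal (σ ^ 2))
      (gaussianReal (f (design n (l + 1))) (Real.toNNReal (σ ^ 2))) := by
    refine HasSubgaussianMGF.of_map (X := id) (by fun_prop) ?_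
    rw [gaussianReal_map_sub_const, sub_self]
    exact hasSubgaussianMGF_gaussianReal _
  have h2 : HasSubgaussianMGF (fun y : Fin n → ℝ => y l - f (design n (l + 1)))
      (Real.toNNReal (σ ^ 2)) (dataLaw σ n f) := by
    unfold dataLaw
    refine HasSubgaussianMGF.of_map (X := fun z : ℝ => z - f (design n (l + 1)))
      (Y := fun y : Fin n → ℝ => y l)
      (Measurable.aemeasurable (measurable_pi_apply (X := fun _ : Fin n => ℝ) l)) ?_
    have hmap : Measure.map (fun y : Fin n → ℝ => y l) (Measure.pi fun i : Fin n =>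
        gaussianReal (f (design n (i + 1))) (Real.toNNReal (σ ^ 2)))
        = gaussianReal (f (design n (l + 1))) (Real.toNNReal (σ ^ 2)) :=
      (measurePreserving_eval (fun i : Fin n =>
        gaussianReal (f (design n (i + 1))) (Real.toNNReal (σ ^ 2))) l).map_eq
    rw [hmap]
    exact h1
  have h3 := h2.const_mul c
  rwa [show (⟨c ^ 2, sq_nonneg c⟩ : ℝ≥0) = Real.toNNReal (c ^ 2) from
    (Real.toNNReal_of_nonneg (sq_nonneg c)).symm, ← Real.toNNReal_mul (sq_nonneg c)] at h3

lemma dataLaw_le_abs_sum {σ : ℝ} (hσ : 0 < σ) {n : ℕ} (f : ℝ → ℝ) (c : Fin n → ℝ) {V s : ℝ}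
    (hV : 0 < V) (hc : ∑ l, c l ^ 2 ≤ V) (hs : 0 ≤ s) :
    dataLaw σ n f {y | s ≤ |∑ l, c l * (y l - f (design n (l + 1)))|}
      ≤ ENNReal.ofReal (2 * Real.exp (-s ^ 2 / (2 * (σ ^ 2 * V)))) := by
  have hind : iIndepFun (fun (l : Fin n) (y : Fin n → ℝ) => c l * (y l - f (design n (l + 1))))
      (dataLaw σ n f) :=
    iIndepFun_pi (X := fun (l : Fin n) (z : ℝ) => c l * (z - f (design n (l + 1))))
      (fun l => by fun_prop)
  have hsub := HasSubgaussianMGF.sum_of_iIndepFun hind (s := Finset.univ)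
    (fun l _ => hasSubgaussianMGF_coord σ f (c l) l)
  set C : ℝ≥0 := ∑ l, Real.toNNReal (c l ^ 2 * σ ^ 2) with hCdef
  have hC : (C : ℝ) ≤ σ ^ 2 * V := by
    rw [hCdef]
    rw [NNReal.coe_sum, Finset.sum_congr rfl fun l _ =>
      Real.coe_toNNReal (c l ^ 2 * σ ^ 2) (by positivity), ← Finset.sum_mul, mul_comm]
    exact mul_le_mul_of_nonneg_left hc (sq_nonneg σ)
  have hV' : 0 < σ ^ 2 * V := by positivity
  have hsub' : HasSubgaussianMGF (fun y : Fin n → ℝ => ∑ l, c l * (y l - f (design n (l + 1))))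
      (Real.toNNReal (σ ^ 2 * V)) (dataLaw σ n f) :=
    ⟨hsub.integrable_exp_mul, fun t => (hsub.mgf_le t).trans (Real.exp_le_exp.mpr (by
      have : (C : ℝ) * t ^ 2 ≤ σ ^ 2 * V * t ^ 2 := mul_le_mul_of_nonneg_right hC (sq_nonneg t)
      rw [Real.coe_toNNReal _ hV'.le]; linarith))⟩
  have h1 := hsub'.measure_ge_le hs
  have h2 := hsub'.neg.measure_ge_le hs
  rw [Real.coe_toNNReal _ hV'.le] at h1 h2
  simp only [Pi.neg_apply] at h2
  have hset : {y : Fin n → ℝ | s ≤ |∑ l, c l * (y l - f (design n (l + 1)))|}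
      ⊆ {y | s ≤ ∑ l, c l * (y l - f (design n (l + 1)))}
        ∪ {y | s ≤ -∑ l, c l * (y l - f (design n (l + 1)))} := 
    fun y hy => (le_abs (a := s)).mp (show s ≤ |_| from hy)
  rw [← ofReal_measureReal]
  refine ENNReal.ofReal_le_ofReal ?_
  refine ((measureReal_mono hset).trans (measureReal_union_le _ _)).trans ?_
  linarith

lemma dataLaw_noiseMoment_le {σ : ℝ} (hσ : 0 < σ) {K : ℝ → ℝ} (hK : ∀ u, 0 ≤ K u)
    (hsupp : ∀ u, 1 < |u| → K u = 0) {Kmax : ℝ} (hKm : 0 < Kmax) (hKmax : ∀ u, K u ≤ Kmax)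
    {k : ℕ} (f : ℝ → ℝ) {n : ℕ} {h : ℝ} (hh : 0 < h) (hnh : 1 ≤ n * h) (x : ℝ)
    (m : Fin (k + 1)) {s : ℝ} (hs : 0 ≤ s) :
    dataLaw σ n f {y | s ≤ |noiseMoment K h k f y x m|}
      ≤ ENNReal.ofReal (2 * Real.exp (-s ^ 2 / (6 * σ ^ 2 * Kmax ^ 2 * (n * h)))) := by
  have hc : ∑ l : Fin n, (K ((design n (l + 1) - x) / h)
      * polyVec k ((design n (l + 1) - x) / h) m) ^ 2 ≤ 3 * Kmax ^ 2 * (n * h) := by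
    have h1 := abs_sum_kernel_mul_le hK hsupp hKmax hh hnh x (fun l : Fin n =>
      K ((design n (l + 1) - x) / h) * polyVec k ((design n (l + 1) - x) / h) m ^ 2)
      (B := Kmax) hKm.le (fun l hl => by
        rw [abs_mul, abs_of_nonneg (hK _), abs_pow]
        calc _ ≤ Kmax * 1 := mul_le_mul (hKmax _)
              (pow_le_one₀ (abs_nonneg _) (abs_polyVec_le_one hl m)) (by positivity) hKm.le
          _ = Kmax := mul_one _)
    refine (le_of_eq ?_).trans ((le_abs_self _).trans (h1.trans (le_of_eq (by ring))))
    exact Finset.sum_congr rfl fun l _ => by ring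
  have hnh0 : 0 < n * h := by linarith
  have := dataLaw_le_abs_sum hσ f _ (V := 3 * Kmax ^ 2 * (n * h)) (by positivity) hc hs
  rwa [show 2 * (σ ^ 2 * (3 * Kmax ^ 2 * (n * h))) = 6 * σ ^ 2 * Kmax ^ 2 * (n * h) by ring]
    at this

/-- With a number of normal equations of order `n`, a union bound controls all noise moments. -/
lemma dataLaw_exists_noiseMoment_le {σ : ℝ} (hσ : 0 < σ) {K : ℝ → ℝ} (hK : ∀ u, 0 ≤ K u)
    (hsupp : ∀ u, 1 < |u| → K u = 0) {Kmax : ℝ} (hKm : 0 < Kmax) (hKmax : ∀ u, K u ≤ Kmax)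
    {k : ℕ} (hk : k ≤ 1) (f : ℝ → ℝ) {n : ℕ} {h : ℝ} (hh : 0 < h) (hnh : 1 ≤ n * h)
    {s : ℝ} (hs : 0 ≤ s) :
    dataLaw σ n f {y | ∃ i ∈ Finset.Icc 1 n, ∃ m : Fin (k + 1),
        s ≤ |noiseMoment K h k f y (design n i) m|}
      ≤ ENNReal.ofReal (4 * n * Real.exp (-s ^ 2 / (6 * σ ^ 2 * Kmax ^ 2 * (n * h)))) := by
  have hset : {y : Fin n → ℝ | ∃ i ∈ Finset.Icc 1 n, ∃ m : Fin (k + 1),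
      s ≤ |noiseMoment K h k f y (design n i) m|}
      = ⋃ q ∈ (Finset.Icc 1 n) ×ˢ (Finset.univ : Finset (Fin (k + 1))),
        {y | s ≤ |noiseMoment K h k f y (design n q.1) q.2|} := by
    ext y
    simp only [Set.mem_ofPred_eq, Set.mem_iUnion, Finset.mem_product, Finset.mem_univ, and_true,
      exists_prop, Prod.exists]
    constructor
    · rintro ⟨i, hi, m, hm⟩; exact ⟨i, m, hi, hm⟩
    · rintro ⟨i, m, hi, hm⟩; exact ⟨i, hi, m, hm⟩
  rw [hset]
  refine (measure_biUnion_finset_le _ _).trans ?_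
  refine (Finset.sum_le_sum fun q _ =>
    dataLaw_noiseMoment_le hσ hK hsupp hKm hKmax f hh hnh (design n q.1) q.2 hs).trans ?_
  rw [Finset.sum_const, nsmul_eq_mul, ← ENNReal.ofReal_natCast, ← ENNReal.ofReal_mul (by positivity)]
  refine ENNReal.ofReal_le_ofReal ?_
  rw [Finset.card_product, Nat.card_Icc, Finset.card_univ, Fintype.card_fin, Nat.add_sub_cancel]
  have hk2 : ((k : ℝ) + 1) ≤ 2 := by exact_mod_cast (by omega : k + 1 ≤ 2)
  push_cast
  set E := Real.exp (-s ^ 2 / (6 * σ ^ 2 * Kmax ^ 2 * (n * h)))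
  have hE : 0 ≤ (n : ℝ) * (2 * E) := by positivity
  nlinarith

end FOMT

/-! ### Bandwidth, separation rate and critical values -/

namespace FOMT

lemma tendsto_log_div_nat : Tendsto (fun n : ℕ => Real.log n / n) atTop (nhds 0) :=
  (Real.isLittleO_log_id_atTop.tendsto_div_nhds_zero).comp tendsto_natCast_atTop_atTop

lemma log_div_pos {n : ℕ} (hn : 2 ≤ n) : 0 < Real.log n / n := by
  have h : (1 : ℝ) < n := by exact_mod_cast hn
  exact div_pos (Real.log_pos h) (by linarith)

namespace Params

variable {p : Params}

lemma Admissible.Kmax_pos (hp : p.Admissible) : 0 < p.Kmax := by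
  obtain ⟨Kmin, δ, h1, h2, h3⟩ := hp.K_lower
  exact h1.trans_le ((h3 0 (by simpa using h2.le)).trans (hp.K_upper 0))

lemma Admissible.integral_sq_pos (hp : p.Admissible) : 0 < ∫ u, p.K u ^ 2 := by
  have hlip : LipschitzWith (Real.toNNReal p.LK) p.K := by
    refine LipschitzWith.of_dist_le_mul fun u v => ?_
    rw [Real.coe_toNNReal _ hp.LK_pos.le, Real.dist_eq, Real.dist_eq]
    exact hp.K_lipschitz u v
  have hsupp : HasCompactSupport fun u => p.K u ^ 2 := by
    refine HasCompactSupport.intro (isCompact_Icc (a := (-1 : ℝ)) (b := 1)) fun u hu => ?_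
    rw [hp.K_support u, zero_pow two_ne_zero]
    by_contra hcon
    exact hu (abs_le.mp (not_lt.mp hcon))
  obtain ⟨Kmin, δ, h1, h2, h3⟩ := hp.K_lower
  have hK0 : 0 < p.K 0 := h1.trans_le (h3 0 (by simpa using h2.le))
  exact (hlip.continuous.pow 2).integral_pos_of_hasCompactSupport_nonneg_nonzero hsupp
    (fun u => sq_nonneg _) (x := 0) (pow_pos hK0 2).ne'

lemma Admissible.Ch_pos (hp : p.Admissible) : 0 < p.Ch := by
  have h1 := hp.Kmax_pos
  have h2 := hp.integral_sq_pos
  have h3 := hp.L_pos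
  have h4 := hp.lam_pos
  have h5 := hp.σ_pos
  have h6 := hp.β_pos
  have h7 : (0 : ℝ) < ⌈p.β⌉₊ := by exact_mod_cast Nat.ceil_pos.mpr h6
  have hq1 : 0 < p.q1 := by unfold q1 Cstar; positivity
  have hq2 : 0 < p.q2 := by unfold q2; positivity
  unfold Ch
  positivity

lemma Admissible.bandwidth_pos (hp : p.Admissible) {n : ℕ} (hn : 2 ≤ n) : 0 < p.bandwidth n := by
  have := hp.Ch_pos
  have := log_div_pos hn
  unfold bandwidth
  positivity

lemma Admissible.tendsto_bandwidth (hp : p.Admissible) : Tendsto p.bandwidth atTop (nhds 0) := by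
  have hβ := hp.β_pos
  have h1 : (0 : ℝ) < 1 / (2 * p.β + 1) := by positivity
  have := (tendsto_log_div_nat.rpow_const (p := 1 / (2 * p.β + 1)) (Or.inr h1.le)).const_mul p.Ch
  rw [Real.zero_rpow h1.ne', mul_zero] at this
  exact this

/-- The bandwidth balances bias and noise: `n h ^ (2 β + 1)` is a constant multiple of `log n`. -/
lemma Admissible.nat_mul_bandwidth_rpow (hp : p.Admissible) {n : ℕ} (hn : 2 ≤ n) :
    n * p.bandwidth n ^ (2 * p.β + 1) = p.Ch ^ (2 * p.β + 1) * Real.log n := by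
  have hβ := hp.β_pos
  have hl := log_div_pos hn
  have hn0 : (0 : ℝ) < n := by positivity
  rw [bandwidth, Real.mul_rpow hp.Ch_pos.le (by positivity), ← Real.rpow_mul hl.le,
    one_div_mul_cancel (by positivity), Real.rpow_one]
  field_simp

lemma Admissible.tendsto_nat_mul_bandwidth (hp : p.Admissible) :
    Tendsto (fun n : ℕ => n * p.bandwidth n) atTop atTop := by
  have hβ := hp.β_pos
  have h1 : Tendsto (fun n : ℕ => p.Ch ^ (2 * p.β + 1) * Real.log n) atTop atTop :=
    (Real.tendsto_log_atTop.comp tendsto_natCast_atTop_atTop).const_mul_atTop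
      (Real.rpow_pos_of_pos hp.Ch_pos _)
  refine tendsto_atTop_mono' _ ?_ h1
  filter_upwards [eventually_ge_atTop 2,
    hp.tendsto_bandwidth.eventually_le_const (zero_lt_one)] with n hn hh
  rw [← hp.nat_mul_bandwidth_rpow hn]
  have hpos := hp.bandwidth_pos hn
  refine mul_le_mul_of_nonneg_left ?_ (by positivity)
  calc p.bandwidth n ^ (2 * p.β + 1) ≤ p.bandwidth n ^ (1 : ℝ) :=
        Real.rpow_le_rpow_of_exponent_ge hpos hh (by linarith)
    _ = _ := Real.rpow_one _

lemma Admissible.sepRate_eq (hp : p.Admissible) {n : ℕ} (hn : 2 ≤ n) :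
    sepRate p.β n = p.bandwidth n ^ (p.β - (⌈p.β⌉₊ : ℝ) + 1)
      / p.Ch ^ (p.β - (⌈p.β⌉₊ : ℝ) + 1) := by
  have hβ := hp.β_pos
  have hl := log_div_pos hn
  have hC := hp.Ch_pos
  rw [sepRate, bandwidth, Real.mul_rpow hC.le (by positivity), ← Real.rpow_mul hl.le,
    mul_div_cancel_left₀ _ (Real.rpow_pos_of_pos hC _).ne', one_div_mul_eq_div]

lemma Admissible.eventually_Nmax_le (hp : p.Admissible) {α : ℝ} (hα : 0 < α) (hα1 : α < 1) :
    ∀ᶠ n in atTop, 0 < p.Nmax α n ∧ p.Nmax α n ≤ α * (n : ℝ) ^ 2 := by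
  have hlogα : Real.log (α / 2) < 0 := Real.log_neg (by positivity) (by linarith)
  have hlog2 : 0 < Real.log 2 := Real.log_pos one_lt_two
  set A := 40 / Real.log 2 * (-2 * Real.log (α / 2)) with hA
  have hA0 : 0 < A := mul_pos (by positivity) (by linarith)
  have hlog : Tendsto (fun n : ℕ => Real.log n ^ 2 / n) atTop (nhds 0) :=
    ((Real.isLittleO_pow_log_id_atTop (n := 2)).tendsto_div_nhds_zero).comp
      tendsto_natCast_atTop_atTop
  filter_upwards [eventually_ge_atTop 2, hlog.eventually_le_const (by positivity : 0 < α / A),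
    hp.tendsto_nat_mul_bandwidth.eventually_ge_atTop 1] with n hn h1 h2
  have hh := hp.bandwidth_pos hn
  have hn0 : (0 : ℝ) < n := by positivity
  have hn1 : (1 : ℝ) < n := by exact_mod_cast hn
  have hl := Real.log_pos hn1
  have e : p.Nmax α n = A * (p.bandwidth n)⁻¹ * Real.log n ^ 2 := by
    rw [Nmax, Cn, hA]; ring
  rw [e]
  refine ⟨by positivity, ?_⟩
  have h3 : (p.bandwidth n)⁻¹ ≤ n := by
    rw [inv_le_iff_one_le_mul₀ hh]; exact h2
  rw [div_le_div_iff₀ hn0 hA0] at h1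
  calc A * (p.bandwidth n)⁻¹ * Real.log n ^ 2 ≤ A * n * Real.log n ^ 2 := by gcongr
    _ = n * (Real.log n ^ 2 * A) := by ring
    _ ≤ n * (α * n) := mul_le_mul_of_nonneg_left h1 hn0.le
    _ = _ := by ring

/-- The critical values are of order `h ^ β`, with a constant that does not depend on the level. -/
lemma Admissible.exists_crit_le (hp : p.Admissible) : ∃ D : ℝ, 0 ≤ D ∧ ∀ α : ℝ, 0 < α → α < 1 →
    ∀ᶠ n in atTop, ∀ i j, p.crit α n i j ≤ D * p.bandwidth n ^ p.β := by
  have hβ := hp.β_pos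
  have hC := hp.Ch_pos
  have hW : 0 ≤ p.W := le_max_of_le_left (by positivity)
  have hσ := hp.σ_pos
  have hL := hp.L_pos
  have hm : 0 ≤ max (16 * p.Kmax / p.lam) 2 := le_max_of_le_right zero_le_two
  refine ⟨p.σ * √(4 * p.W) * p.Ch ^ (-(p.β + 1 / 2)) + max (16 * p.Kmax / p.lam) 2 * p.L,
    by positivity, fun α hα hα1 => ?_⟩
  filter_upwards [eventually_ge_atTop 2, hp.eventually_Nmax_le hα hα1] with n hn hN i j
  obtain ⟨hN0, hN1⟩ := hN
  have hh := hp.bandwidth_pos hn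
  have hn0 : (0 : ℝ) < n := by positivity
  have hn1 : (1 : ℝ) < n := by exact_mod_cast hn
  have hl := Real.log_pos hn1
  have hkey := hp.nat_mul_bandwidth_rpow hn
  set h := p.bandwidth n with hdef
  have hhβ := Real.rpow_pos_of_pos hh p.β
  rw [crit, add_mul]
  refine add_le_add ?_ ?_
  · have h1 : -2 * Real.log (α / p.Nmax α n) * p.W ≤ 4 * p.W * Real.log n := by
      have h2 : -(2 * Real.log n) ≤ Real.log (α / p.Nmax α n) := by
        have : -(2 * Real.log n) = Real.log (((n : ℝ) ^ 2)⁻¹) := by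
          rw [Real.log_inv, Real.log_pow]; norm_num
        rw [this]
        refine Real.log_le_log (by positivity) ?_
        rw [inv_le_iff_one_le_mul₀ (by positivity), div_mul_eq_mul_div, le_div_iff₀ hN0, one_mul]
        exact hN1
      nlinarith
    have hlog : Real.log n = n * h ^ (2 * p.β + 1) * p.Ch ^ (-(2 * p.β + 1)) := by
      rw [hkey, Real.rpow_neg hC.le]
      have := (Real.rpow_pos_of_pos hC (2 * p.β + 1)).ne'
      field_simp
    have hsqrt : √(Real.log n) = (n : ℝ) ^ (1 / 2 : ℝ) * h ^ (p.β + 1 / 2)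
        * p.Ch ^ (-(p.β + 1 / 2)) := by
      rw [Real.sqrt_eq_rpow, hlog, Real.mul_rpow (by positivity) (by positivity),
        Real.mul_rpow (by positivity) (by positivity), ← Real.rpow_mul hh.le,
        ← Real.rpow_mul hC.le]
      congr 2
      · congr 1; ring
      · ring
    have hs : √(-2 * Real.log (α / p.Nmax α n) * p.W) ≤ √(4 * p.W) * √(Real.log n) := by
      rw [← Real.sqrt_mul (by positivity)]; exact Real.sqrt_le_sqrt h1
    unfold critRandom
    rw [← hdef]
    refine (mul_le_mul_of_nonneg_left (min_le_right _ _) (by positivity)).trans ?_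
    calc _ ≤ p.σ * (√(4 * p.W) * √(Real.log n)) * (n : ℝ) ^ (-(1 / 2) : ℝ)
          * h ^ (-(3 / 2) : ℝ) * h := by gcongr
      _ = p.σ * √(4 * p.W) * p.Ch ^ (-(p.β + 1 / 2))
          * (((n : ℝ) ^ (1 / 2 : ℝ) * (n : ℝ) ^ (-(1 / 2) : ℝ))
            * (h ^ (p.β + 1 / 2) * h ^ (-(3 / 2) : ℝ) * h)) := by rw [hsqrt]; ring
      _ = _ := by
          rw [← Real.rpow_add hn0, ← Real.rpow_add hh, ← Real.rpow_add_one hh.ne']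
          norm_num
          left; congr 1; ring
  · unfold critBias
    rw [← hdef]
    split_ifs
    · positivity
    · exact le_rfl

end Params

/-! ### Windows on which an alternative drops -/

namespace Params

/-- Every alternative at distance a large multiple of the separation rate drops by `M h ^ β`
from any point of one window of width `2 h` to any point of another one. For `β ≤ 1` these
are neighbourhoods of the two points where monotonicity fails, for `β > 1` the outer thirds of
an interval of length `6 h` on which the derivative is negative. -/
lemma Admissible.exists_windows {p : Params} (hp : p.Admissible) {M : ℝ} (hM : 0 ≤ M) :
    ∃ C₀ : ℝ, ∀ C ≥ C₀, ∀ᶠ n in atTop, ∀ f ∈ altClass p.β p.L (C * sepRate p.β n),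
      ∃ u v : ℝ, 0 ≤ u ∧ u + 2 * p.bandwidth n < v ∧ v + 2 * p.bandwidth n ≤ 1 ∧
        ∀ s ∈ Icc u (u + 2 * p.bandwidth n), ∀ t ∈ Icc v (v + 2 * p.bandwidth n),
          M * p.bandwidth n ^ p.β ≤ f s - f t := by
  have hβ := hp.β_pos
  have hL := hp.L_pos
  set E := p.Ch ^ (p.β - (⌈p.β⌉₊ : ℝ) + 1) with hE
  have hE0 : 0 < E := Real.rpow_pos_of_pos hp.Ch_pos _
  refine ⟨12 * p.L * E + 2 * M * E, fun C hC => ?_⟩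
  filter_upwards [eventually_ge_atTop 2,
    hp.tendsto_bandwidth.eventually_le_const (by norm_num : (0 : ℝ) < 1 / 12)] with n hn hh1 f hf
  have hh := hp.bandwidth_pos hn
  have hrate := hp.sepRate_eq hn
  rw [← hE] at hrate
  set h := p.bandwidth n with hdef
  set Δ := C * sepRate p.β n with hΔ
  have hΔ1 : (12 * p.L + 2 * M) * h ^ (p.β - (⌈p.β⌉₊ : ℝ) + 1) ≤ Δ := by
    rw [hΔ, hrate, mul_div_assoc', le_div_iff₀ hE0]
    have := mul_le_mul_of_nonneg_right hC
      (Real.rpow_pos_of_pos hh (p.β - (⌈p.β⌉₊ : ℝ) + 1)).le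
    linarith
  obtain ⟨hfH, hfa⟩ := hf
  rcases le_or_gt p.β 1 with hb | hb
  · rw [if_pos hb] at hfa
    rw [natCeil_of_le_one hβ hb, show p.β - ((1 : ℕ) : ℝ) + 1 = p.β by norm_num] at hΔ1
    rw [mem_holderClass_of_le_one hβ hb] at hfH
    obtain ⟨a, b, ha, hab, hb1, hdrop⟩ := hfa
    have hhβ := Real.rpow_pos_of_pos hh p.β
    have h2 : (2 * h) ^ p.β ≤ 2 * h ^ p.β := by
      rw [Real.mul_rpow zero_le_two hh.le]
      refine mul_le_mul_of_nonneg_right ?_ hhβ.le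
      calc (2 : ℝ) ^ p.β ≤ 2 ^ (1 : ℝ) := Real.rpow_le_rpow_of_exponent_le one_le_two hb
        _ = 2 := Real.rpow_one 2
    have h4 : (4 * h) ^ p.β ≤ 4 * h ^ p.β := by
      rw [Real.mul_rpow (by norm_num) hh.le]
      refine mul_le_mul_of_nonneg_right ?_ hhβ.le
      calc (4 : ℝ) ^ p.β ≤ 4 ^ (1 : ℝ) := Real.rpow_le_rpow_of_exponent_le (by norm_num) hb
        _ = 4 := Real.rpow_one 4
    have hLh : 0 < p.L * h ^ p.β := by positivity
    have hMh : 0 ≤ M * h ^ p.β := by positivity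
    have hloc : ∀ x ∈ Icc (0 : ℝ) 1, ∀ y ∈ Icc (0 : ℝ) 1, |x - y| ≤ 2 * h →
        |f x - f y| ≤ 2 * (p.L * h ^ p.β) := by
      intro x hx y hy hxy
      have h3 : |x - y| ^ p.β ≤ 2 * h ^ p.β :=
        (Real.rpow_le_rpow (abs_nonneg _) hxy hβ.le).trans h2
      have := mul_le_mul_of_nonneg_left h3 hL.le
      linarith [hfH.2 x hx y hy]
    have haI : a ∈ Icc (0 : ℝ) 1 := ⟨ha, by linarith⟩
    have hbI : b ∈ Icc (0 : ℝ) 1 := ⟨by linarith, hb1⟩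
    have hsep : 4 * h < b - a := by
      by_contra hcon
      have h3 : |a - b| ^ p.β ≤ 4 * h ^ p.β := by
        refine (Real.rpow_le_rpow (abs_nonneg _) ?_ hβ.le).trans h4
        rw [abs_sub_comm, abs_of_pos (by linarith)]; linarith
      have h5 := mul_le_mul_of_nonneg_left h3 hL.le
      have h6 := (le_abs_self _).trans (hfH.2 a haI b hbI)
      linarith
    refine ⟨a, b - 2 * h, ha, by linarith, by linarith, fun s hs t ht => ?_⟩
    have h7 := abs_le.mp (hloc s ⟨by linarith [hs.1], by linarith [hs.2]⟩ a haI
      (abs_le.mpr ⟨by linarith [hs.1], by linarith [hs.2]⟩))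
    have h8 := abs_le.mp (hloc t ⟨by linarith [ht.1], by linarith [ht.2]⟩ b hbI
      (abs_le.mpr ⟨by linarith [ht.1], by linarith [ht.2]⟩))
    linarith [h7.1, h8.2]
  · rw [if_neg (not_le.mpr hb)] at hfa
    rw [natCeil_of_one_lt hb hp.β_le,
      show p.β - ((2 : ℕ) : ℝ) + 1 = p.β - 1 by norm_num; ring] at hΔ1
    rw [mem_holderClass_of_one_lt hb hp.β_le] at hfH
    obtain ⟨x, hx, hder⟩ := hfa
    have hhβ := Real.rpow_pos_of_pos hh (p.β - 1)
    have hγ : 0 ≤ p.β - 1 := by linarith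
    have h6 : (6 * h) ^ (p.β - 1) ≤ 6 * h ^ (p.β - 1) := by
      rw [Real.mul_rpow (by norm_num) hh.le]
      refine mul_le_mul_of_nonneg_right ?_ hhβ.le
      calc (6 : ℝ) ^ (p.β - 1) ≤ 6 ^ (1 : ℝ) :=
            Real.rpow_le_rpow_of_exponent_le (by norm_num) (by linarith [hp.β_le])
        _ = 6 := Real.rpow_one 6
    have hLh : 0 < p.L * h ^ (p.β - 1) := by positivity
    have hMh : 0 ≤ M * h ^ (p.β - 1) := by positivity
    obtain ⟨u, hu0, hu1, hux1, hux2⟩ :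
        ∃ u : ℝ, 0 ≤ u ∧ u + 6 * h ≤ 1 ∧ u ≤ x ∧ x ≤ u + 6 * h := by
      rcases le_total x (1 / 2) with h3 | h3
      · exact ⟨x, hx.1, by linarith, le_rfl, by linarith⟩
      · exact ⟨x - 6 * h, by linarith, by linarith [hx.2], by linarith, by linarith⟩
    have hder' : ∀ z ∈ Icc u (u + 6 * h), derivWithin f (Icc 0 1) z ≤ -(Δ / 2) := by
      intro z hz
      have h7 : |z - x| ^ (p.β - 1) ≤ 6 * h ^ (p.β - 1) := by
        refine (Real.rpow_le_rpow (abs_nonneg _) ?_ hγ).trans h6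
        exact abs_le.mpr ⟨by linarith [hz.1], by linarith [hz.2]⟩
      have h8 := mul_le_mul_of_nonneg_left h7 hL.le
      have h9 := (le_abs_self _).trans
        (hfH.2 z ⟨by linarith [hz.1], by linarith [hz.2]⟩ x hx)
      linarith
    have hmem : ∀ z ∈ interior (Icc u (u + 6 * h)), Icc (0 : ℝ) 1 ∈ nhds z := by
      intro z hz
      rw [interior_Icc] at hz
      exact Icc_mem_nhds (by linarith [hz.1]) (by linarith [hz.2])
    have hsub : Icc u (u + 6 * h) ⊆ Icc (0 : ℝ) 1 := Icc_subset_Icc hu0 hu1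
    have hmvt := Convex.image_sub_le_mul_sub_of_deriv_le (convex_Icc u (u + 6 * h))
      (f := f) (hfH.1.continuousOn.mono hsub)
      (fun z hz => ((hasDerivWithinAt_of_contDiffOn hfH.1
        (hsub (interior_subset hz))).hasDerivAt (hmem z hz)).differentiableAt.differentiableWithinAt)
      (C := -(Δ / 2)) (fun z hz => by
        rw [← derivWithin_of_mem_nhds (hmem z hz)]
        exact hder' z (interior_subset hz))
    refine ⟨u, u + 4 * h, hu0, by linarith, by linarith, fun s hs t ht => ?_⟩
    have h7 := hmvt s ⟨hs.1, by linarith [hs.2]⟩ t ⟨by linarith [ht.1], by linarith [ht.2]⟩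
      (by linarith [hs.2, ht.1])
    have h8 : M * h ^ (p.β - 1) ≤ Δ / 2 := by linarith
    have h9 : M * h ^ (p.β - 1) * (2 * h) ≤ Δ / 2 * (t - s) := by
      refine mul_le_mul h8 (by linarith [hs.2, ht.1]) (by positivity) (by linarith)
    have h10 : h ^ p.β = h ^ (p.β - 1) * h := by
      rw [← Real.rpow_add_one hh.ne']; congr 1; ring
    have h11 : 0 ≤ M * h ^ (p.β - 1) * h := by positivity
    rw [h10]
    linarith

end Params

end FOMT

/-! ### Power of the test -/

namespace FOMT

lemma order_le_one {β : ℝ} (h2 : β ≤ 2) : order β ≤ 1 := by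
  have : ⌈β⌉₊ ≤ 2 := Nat.ceil_le.mpr (by exact_mod_cast h2)
  rw [order]; omega

lemma measurable_noiseMoment (K : ℝ → ℝ) (h : ℝ) (k : ℕ) (f : ℝ → ℝ) (n : ℕ) (x : ℝ)
    (m : Fin (k + 1)) : Measurable fun y : Fin n → ℝ => noiseMoment K h k f y x m := by
  unfold noiseMoment
  fun_prop

namespace Params

/-- On the event that the noise moments are small, the test rejects an alternative with
probability at least `1 - α / 2`. -/
lemma Admissible.exists_eventually_accProb_le {p : Params} (hp : p.Admissible) {M₁ : ℝ}
    (hM₁ : 0 ≤ M₁) :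
    ∃ C₀ : ℝ, ∀ C ≥ C₀, ∀ α : ℝ, 0 < α → α < 1 → ∀ᶠ n in atTop,
      ∀ f ∈ altClass p.β p.L (C * sepRate p.β n), ∀ y : Fin n → ℝ,
        (∀ i ∈ Finset.Icc 1 n, ∀ m, |noiseMoment p.K (p.bandwidth n) (order p.β) f y (design n i) m|
          ≤ M₁ * p.bandwidth n ^ p.β * (n * p.bandwidth n)) →
        accProb (p.fomt α n y) ≤ α / 2 := by
  obtain ⟨Kmin, δ', hKmin, hδ', hKδ'⟩ := hp.K_lower
  set δ := min δ' 1 with hδdef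
  have hδ : 0 < δ := lt_min hδ' one_pos
  have hδ1 : δ ≤ 1 := min_le_right _ _
  have hKδ : ∀ u, |u| ≤ δ → Kmin ≤ p.K u := fun u hu => hKδ' u (hu.trans (min_le_left _ _))
  obtain ⟨D, hD0, hD⟩ := hp.exists_crit_le
  have hKm := hp.Kmax_pos
  have hL := hp.L_pos
  set B := 3 * ((3 * p.Kmax * p.L + M₁) / (Kmin * δ ^ 3 / 512)) with hB
  have hB0 : 0 ≤ B := by positivity
  obtain ⟨C₀, hC₀⟩ := hp.exists_windows (M := 2 * (2 * B + D) + 1) (by positivity)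
  refine ⟨C₀, fun C hC α hα hα1 => ?_⟩
  have hlog : ∀ᶠ n : ℕ in atTop, (1 : ℝ) ≤ Real.log n :=
    (Real.tendsto_log_atTop.comp tendsto_natCast_atTop_atTop).eventually_ge_atTop 1
  filter_upwards [eventually_ge_atTop 2, hC₀ C hC, hD α hα hα1, hlog,
    hp.tendsto_bandwidth.eventually_le_const (by norm_num : (0 : ℝ) < 1 / 2),
    hp.tendsto_nat_mul_bandwidth.eventually_ge_atTop (4 / δ)]
    with n hn hwin hcrit hl hh1 hnh f hf y hy
  have hh := hp.bandwidth_pos hn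
  have hn1 : 1 ≤ n := by omega
  set h := p.bandwidth n with hdef
  have hhβ := Real.rpow_pos_of_pos hh p.β
  have hnh' : 4 ≤ δ * (n * h) := by
    rw [div_le_iff₀ hδ] at hnh; linarith
  have hnh1 : (1 : ℝ) ≤ n * h := by
    have : (4 : ℝ) / 1 ≤ 4 / δ := div_le_div_of_nonneg_left (by norm_num) hδ hδ1
    linarith
  have herr : ∀ i, 1 ≤ i → i ≤ n → |p.estimate y i - f (design n i)| ≤ B * h ^ p.β := by
    intro i hi hin
    exact abs_lpe_sub_le_of_noise hp.β_pos hp.β_le hL.le hp.K_nonneg hp.K_support hp.K_upper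
      hKmin hδ hδ1 hKδ hf.1 hi hin hh (by linarith) hnh' hM₁ y
      (hy i (Finset.mem_Icc.mpr ⟨hi, hin⟩))
  obtain ⟨u, v, hu0, huv, hv1, hdrop⟩ := hwin f hf
  set δ₀ := (2 * (2 * B + D) + 1) * h ^ p.β with hδ₀
  have htest : ∀ i j, 1 ≤ i → i < j → j ≤ n →
      δ₀ / 2 ≤ f (design n i) - f (design n j) → p.localTest α y i j = true := by
    intro i j hi hij hjn hfd
    have h1 := abs_le.mp (herr i hi (by omega))
    have h2 := abs_le.mp (herr j (by omega) hjn)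
    have h3 := hcrit i j
    rw [localTest, decide_eq_true_iff]
    rw [hδ₀] at hfd
    linarith [h1.1, h2.2]
  have hsub : ∀ a b, designIn n a b ⊆ Finset.Icc 1 n := fun a b => Finset.filter_subset _ _
  have hcard : ∀ a, 0 ≤ a → a + 2 * h ≤ 1 → h * n ≤ ((designIn n a (a + 2 * h)).card : ℝ) := by
    intro a ha0 ha1
    have := le_card_designIn hn1 ha0 ha1 (by positivity)
    linarith
  have hgood := good_of_windows (p := p) (α := α) (y := y) (F := fun i => f (design n i))
    (hsub u (u + 2 * h)) (hsub v (v + 2 * h)) (δ := δ₀) (by positivity) htest (by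
      intro i hi j hj
      have hi' := (Finset.mem_filter.mp hi).2
      have hj' := (Finset.mem_filter.mp hj).2
      refine ⟨?_, hdrop _ hi' _ hj'⟩
      by_contra hcon
      have h1 : design n j ≤ design n i := by
        rw [design, design]
        exact div_le_div_of_nonneg_right (by exact_mod_cast not_lt.mp hcon) (by positivity)
      linarith [hi'.2, hj'.1])
  have hceil : 3 ≤ ⌈20 * Real.log n⌉₊ := by
    have : ((3 : ℕ) : ℝ) ≤ ⌈20 * Real.log n⌉₊ :=
      le_trans (by push_cast; linarith) (Nat.le_ceil (20 * Real.log n))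
    exact_mod_cast this
  rcases hgood with hg | hg
  · exact accProb_fomt_le hα hn1 hceil hh (hsub u (u + 2 * h)) (hcard u hu0 (by linarith))
      fun I hI => Or.inl (hg I hI)
  · exact accProb_fomt_le hα hn1 hceil hh (hsub v (v + 2 * h)) (hcard v (by linarith) hv1)
      fun I hI => Or.inr (hg I hI)

/-- The upper bound: for a large multiple of the separation rate, the test eventually rejects
all alternatives with probability at least `1 - α`. -/
theorem Admissible.le_liminf_rejProb {p : Params} (hp : p.Admissible) :
    ∃ C₀ : ℝ, ∀ C ≥ C₀, ∀ α : ℝ, 0 < α → α < 1 →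
      ENNReal.ofReal (1 - α) ≤ liminf (fun n : ℕ =>
        ⨅ f ∈ altClass p.β p.L (C * sepRate p.β n), rejProb p.σ (p.fomt α n) f) atTop := by
  have hσ := hp.σ_pos
  have hKm := hp.Kmax_pos
  have hC := hp.Ch_pos
  have hCβ := Real.rpow_pos_of_pos hC (2 * p.β + 1)
  -- This value of `M₁` makes the exponent in the noise bound equal to `-2 log n`.
  set M₁ := √(12 * p.σ ^ 2 * p.Kmax ^ 2 / p.Ch ^ (2 * p.β + 1)) with hM₁
  obtain ⟨C₀, hC₀⟩ := hp.exists_eventually_accProb_le (M₁ := M₁) (Real.sqrt_nonneg _)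
  refine ⟨C₀, fun C hCC α hα hα1 => ?_⟩
  refine le_liminf_of_le (by isBoundedDefault) ?_
  filter_upwards [hC₀ C hCC α hα hα1, eventually_ge_atTop 2,
    hp.tendsto_nat_mul_bandwidth.eventually_ge_atTop 1,
    (tendsto_natCast_atTop_atTop (R := ℝ)).eventually_ge_atTop (8 / α)] with n hacc hn hnh hnα
  refine le_iInf₂ fun f hf => ?_
  have hh := hp.bandwidth_pos hn
  have hn0 : (0 : ℝ) < n := by positivity
  have hkey := hp.nat_mul_bandwidth_rpow hn
  set h := p.bandwidth n with hdef
  have hhβ := Real.rpow_pos_of_pos hh p.β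
  set s := M₁ * h ^ p.β * (n * h) with hs
  set Bad := {y : Fin n → ℝ | ∃ i ∈ Finset.Icc 1 n, ∃ m : Fin (order p.β + 1),
        s ≤ |noiseMoment p.K h (order p.β) f y (design n i) m|} with hBad
  have hexp : -s ^ 2 / (6 * p.σ ^ 2 * p.Kmax ^ 2 * (n * h)) = -(2 * Real.log n) := by
    have h1 : M₁ ^ 2 * p.Ch ^ (2 * p.β + 1) = 12 * p.σ ^ 2 * p.Kmax ^ 2 := by
      rw [hM₁, Real.sq_sqrt (by positivity), div_mul_cancel₀ _ hCβ.ne']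
    have h2 : h ^ (2 * p.β + 1) = (h ^ p.β) ^ 2 * h := by
      rw [Real.rpow_add_one hh.ne', two_mul, Real.rpow_add hh, sq]
    have h3 : s ^ 2 = 2 * Real.log n * (6 * p.σ ^ 2 * p.Kmax ^ 2 * (n * h)) := by
      calc s ^ 2 = M₁ ^ 2 * (n * ((h ^ p.β) ^ 2 * h)) * (n * h) := by rw [hs]; ring
        _ = M₁ ^ 2 * p.Ch ^ (2 * p.β + 1) * Real.log n * (n * h) := by rw [← h2, hkey]; ring
        _ = _ := by rw [h1]; ring
    rw [h3, neg_div, mul_div_cancel_right₀ _ (by positivity)]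
  have hPbad : dataLaw p.σ n f Bad ≤ ENNReal.ofReal (α / 2) := by
    refine (dataLaw_exists_noiseMoment_le hσ hp.K_nonneg hp.K_support hKm hp.K_upper
      (order_le_one hp.β_le) f hh hnh (by positivity)).trans (ENNReal.ofReal_le_ofReal ?_)
    rw [hexp, Real.exp_neg, two_mul, Real.exp_add, Real.exp_log hn0]
    rw [div_le_iff₀ hα] at hnα
    have : 4 * (n : ℝ) * ((n : ℝ) * n)⁻¹ = 4 / n := by field_simp
    rw [this, div_le_div_iff₀ hn0 two_pos]
    linarith
  have hmeas : MeasurableSet Bad := by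
    have : Bad = ⋃ i ∈ Finset.Icc 1 n, ⋃ m : Fin (order p.β + 1),
        {y | s ≤ |noiseMoment p.K h (order p.β) f y (design n i) m|} := by
      ext y; simp only [hBad, Set.mem_ofPred_eq, Set.mem_iUnion, exists_prop]
    rw [this]
    refine Finset.measurableSet_biUnion _ fun i _ => MeasurableSet.iUnion fun m => ?_
    exact measurableSet_le measurable_const (measurable_noiseMoment _ _ _ _ _ _ _).abs
  have hgood : ∀ y ∈ Badᶜ, ENNReal.ofReal (1 - α / 2) ≤ p.fomt α n y true := by
    intro y hy
    rw [apply_true_eq]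
    refine ENNReal.ofReal_le_ofReal (sub_le_sub_left (hacc f hf y fun i hi m => ?_) _)
    by_contra hcon
    exact hy ⟨i, hi, m, (not_le.mp hcon).le⟩
  calc ENNReal.ofReal (1 - α)
      ≤ ENNReal.ofReal (1 - α / 2) * ENNReal.ofReal (1 - α / 2) := by
        rw [← ENNReal.ofReal_mul (by linarith)]
        exact ENNReal.ofReal_le_ofReal (by nlinarith)
    _ ≤ ENNReal.ofReal (1 - α / 2) * dataLaw p.σ n f Badᶜ := by
        gcongr
        rw [prob_compl_eq_one_sub hmeas, ENNReal.ofReal_sub _ (by positivity), ENNReal.ofReal_one]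
        exact tsub_le_tsub_left hPbad 1
    _ = ∫⁻ _ in Badᶜ, ENNReal.ofReal (1 - α / 2) ∂(dataLaw p.σ n f) := by
        rw [setLIntegral_const]
    _ ≤ ∫⁻ y in Badᶜ, p.fomt α n y true ∂(dataLaw p.σ n f) :=
        setLIntegral_mono' hmeas.compl hgood
    _ ≤ rejProb p.σ (p.fomt α n) f := setLIntegral_le_lintegral _ _

end Params

end FOMT

/-! ### Likelihood ratios and the second moment method -/

namespace FOMT

/-- The likelihood ratio of the mean vector `g` with respect to the mean vector `0`. -/
noncomputable def likRatio (σ : ℝ) {n : ℕ} (g y : Fin n → ℝ) : ℝ :=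
  Real.exp (∑ l, (g l * y l - g l ^ 2 / 2) / σ ^ 2)

/-- The mean vector `(f (1/n), …, f (n/n))`. -/
noncomputable def meanVec (n : ℕ) (f : ℝ → ℝ) : Fin n → ℝ := fun l => f (design n (l + 1))

/-- The law of pure noise. -/
noncomputable def noiseLaw (σ : ℝ) (n : ℕ) : Measure (Fin n → ℝ) :=
  Measure.pi fun _ : Fin n => gaussianReal 0 (Real.toNNReal (σ ^ 2))

instance isProbabilityMeasure_noiseLaw (σ : ℝ) (n : ℕ) : IsProbabilityMeasure (noiseLaw σ n) := by
  unfold noiseLaw; infer_instance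

lemma dataLaw_zero (σ : ℝ) (n : ℕ) : dataLaw σ n (fun _ => 0) = noiseLaw σ n := rfl

lemma measurable_likRatio (σ : ℝ) {n : ℕ} (g : Fin n → ℝ) : Measurable (likRatio σ g) := by
  unfold likRatio
  fun_prop

lemma likRatio_pos (σ : ℝ) {n : ℕ} (g y : Fin n → ℝ) : 0 < likRatio σ g y := Real.exp_pos _

lemma gaussianReal_eq_withDensity {σ : ℝ} (hσ : 0 < σ) (a : ℝ) :
    gaussianReal a (Real.toNNReal (σ ^ 2)) =
      (gaussianReal 0 (Real.toNNReal (σ ^ 2))).withDensity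
        (fun z => ENNReal.ofReal (Real.exp ((a * z - a ^ 2 / 2) / σ ^ 2))) := by
  have hv : Real.toNNReal (σ ^ 2) ≠ 0 := (Real.toNNReal_pos.mpr (by positivity)).ne'
  rw [gaussianReal_of_var_ne_zero _ hv, gaussianReal_of_var_ne_zero _ hv,
    ← withDensity_mul _ (measurable_gaussianPDF _ _) (by fun_prop)]
  congr 1
  ext z
  rw [Pi.mul_apply, gaussianPDF_def, gaussianPDF_def, ← ENNReal.ofReal_mul
    (gaussianPDFReal_nonneg _ _ _)]
  rw [gaussianPDFReal_def, gaussianPDFReal_def]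
  simp only
  rw [mul_assoc _ (Real.exp _) (Real.exp _), ← Real.exp_add, Real.coe_toNNReal _ (by positivity)]
  congr 3
  field_simp
  ring

lemma pi_gaussianReal_eq_withDensity {σ : ℝ} (hσ : 0 < σ) {n : ℕ} (g : Fin n → ℝ) :
    (Measure.pi fun l : Fin n => gaussianReal (g l) (Real.toNNReal (σ ^ 2))) =
      (noiseLaw σ n).withDensity (fun y => ENNReal.ofReal (likRatio σ g y)) := by
  refine Measure.pi_eq fun s hs => ?_
  set ρ : Fin n → ℝ → ℝ≥0∞ := fun l z =>
    ENNReal.ofReal (Real.exp ((g l * z - g l ^ 2 / 2) / σ ^ 2)) with hρ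
  have hρm : ∀ l, Measurable (ρ l) := fun l => by simp only [hρ]; fun_prop
  set X : Fin n → ℝ → ℝ≥0∞ := fun l => (s l).indicator (ρ l) with hX
  have hXm : ∀ l, Measurable (X l) := fun l => (hρm l).indicator (hs l)
  rw [withDensity_apply _ (MeasurableSet.univ_pi hs), ← lintegral_indicator (MeasurableSet.univ_pi hs)]
  have hpt : ∀ y, (Set.univ.pi s).indicator (fun y => ENNReal.ofReal (likRatio σ g y)) y
      = ∏ l, X l (y l) := by
    intro y
    by_cases hy : y ∈ Set.univ.pi s
    · rw [Set.indicator_of_mem hy, likRatio, Real.exp_sum,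
        ENNReal.ofReal_prod_of_nonneg fun l _ => (Real.exp_pos _).le]
      exact Finset.prod_congr rfl fun l _ => by
        rw [hX]; simp only [Set.indicator_of_mem (hy l (Set.mem_univ l)), hρ]
    · rw [Set.indicator_of_notMem hy]
      simp only [Set.mem_univ_pi, not_forall] at hy
      obtain ⟨l, hl⟩ := hy
      exact (Finset.prod_eq_zero (Finset.mem_univ l) (Set.indicator_of_notMem hl _)).symm
  rw [lintegral_congr hpt]
  have hind : iIndepFun (fun (l : Fin n) (y : Fin n → ℝ) => X l (y l)) (noiseLaw σ n) :=
    iIndepFun_pi fun l => (hXm l).aemeasurable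
  rw [lintegral_prod_eq_prod_lintegral_of_indepFun _ _ hind
    (fun l => (hXm l).comp (measurable_pi_apply l))]
  refine Finset.prod_congr rfl fun l _ => ?_
  have hmp : MeasurePreserving (fun y : Fin n → ℝ => y l) (noiseLaw σ n)
      (gaussianReal 0 (Real.toNNReal (σ ^ 2))) :=
    measurePreserving_eval (fun _ : Fin n => gaussianReal 0 (Real.toNNReal (σ ^ 2))) l
  rw [hmp.lintegral_comp (hXm l), gaussianReal_eq_withDensity hσ (g l),
    withDensity_apply _ (hs l), ← lintegral_indicator (hs l)]

lemma rejProb_eq_lintegral_likRatio {σ : ℝ} (hσ : 0 < σ) {n : ℕ} (Ψ : RandTest n)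
    (hΨ : Measurable fun y => Ψ y true) (f : ℝ → ℝ) :
    rejProb σ Ψ f = ∫⁻ y, ENNReal.ofReal (likRatio σ (meanVec n f) y) * Ψ y true ∂noiseLaw σ n := by
  have h : dataLaw σ n f = (noiseLaw σ n).withDensity
      (fun y => ENNReal.ofReal (likRatio σ (meanVec n f) y)) :=
    pi_gaussianReal_eq_withDensity hσ (meanVec n f)
  rw [rejProb, h, lintegral_withDensity_eq_lintegral_mul _
    (measurable_likRatio σ _).ennreal_ofReal hΨ]
  rfl

lemma lintegral_likRatio {σ : ℝ} (hσ : 0 < σ) {n : ℕ} (g : Fin n → ℝ) :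
    ∫⁻ y, ENNReal.ofReal (likRatio σ g y) ∂noiseLaw σ n = 1 := by
  rw [← setLIntegral_univ, ← withDensity_apply _ MeasurableSet.univ,
    ← pi_gaussianReal_eq_withDensity hσ g, measure_univ]

lemma integrable_likRatio {σ : ℝ} (hσ : 0 < σ) {n : ℕ} (g : Fin n → ℝ) :
    Integrable (likRatio σ g) (noiseLaw σ n) := by
  refine ⟨(measurable_likRatio σ g).aestronglyMeasurable, ?_⟩
  rw [hasFiniteIntegral_iff_ofReal (ae_of_all _ fun y => (likRatio_pos σ g y).le),
    lintegral_likRatio hσ]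
  exact ENNReal.one_lt_top

lemma integral_likRatio {σ : ℝ} (hσ : 0 < σ) {n : ℕ} (g : Fin n → ℝ) :
    ∫ y, likRatio σ g y ∂noiseLaw σ n = 1 := by
  rw [integral_eq_lintegral_of_nonneg_ae (ae_of_all _ fun y => (likRatio_pos σ g y).le)
    (measurable_likRatio σ g).aestronglyMeasurable, lintegral_likRatio hσ, ENNReal.toReal_one]

lemma likRatio_mul (σ : ℝ) {n : ℕ} (g g' y : Fin n → ℝ) :
    likRatio σ g y * likRatio σ g' y
      = Real.exp ((∑ l, g l * g' l) / σ ^ 2) * likRatio σ (g + g') y := by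
  rw [likRatio, likRatio, likRatio, ← Real.exp_add, ← Real.exp_add, Finset.sum_div,
    ← Finset.sum_add_distrib, ← Finset.sum_add_distrib]
  congr 1
  exact Finset.sum_congr rfl fun l _ => by simp only [Pi.add_apply]; ring

/-- The second moment method. For a uniform mixture of `m` orthogonal alternatives with
`‖g_k‖² ≤ Q σ²` the `χ²`-distance to pure noise is at most `exp Q / m`. If it is at most `ε²`,
then some alternative is rejected with at most the probability under pure noise plus `2 ε`. -/
lemma exists_rejProb_le {σ : ℝ} (hσ : 0 < σ) {n m : ℕ} (hm : 0 < m) (f : Fin m → ℝ → ℝ)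
    (horth : ∀ j k, j ≠ k → ∑ l, meanVec n (f j) l * meanVec n (f k) l = 0) {Q ε : ℝ}
    (hQ : ∀ k, (∑ l, meanVec n (f k) l * meanVec n (f k) l) / σ ^ 2 ≤ Q) (hε : 0 < ε)
    (hχ : Real.exp Q / m ≤ ε ^ 2) (Ψ : RandTest n) (hΨ : Measurable fun y => Ψ y true) :
    ∃ k, rejProb σ Ψ (f k) ≤ rejProb σ Ψ (fun _ => 0) + ENNReal.ofReal (2 * ε) := by
  have hm0 : (0 : ℝ) < m := by exact_mod_cast hm
  set R : Fin m → (Fin n → ℝ) → ℝ := fun k => likRatio σ (meanVec n (f k)) with hR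
  set Z : (Fin n → ℝ) → ℝ := fun y => (m : ℝ)⁻¹ * ∑ k, R k y with hZ
  have hRint : ∀ k, Integrable (R k) (noiseLaw σ n) := fun k => integrable_likRatio hσ _
  have hRR : ∀ j k, Integrable (fun y => R j y * R k y) (noiseLaw σ n) := fun j k => by
    simp only [hR, likRatio_mul]
    exact (integrable_likRatio hσ _).const_mul _
  have hRRval : ∀ j k, ∫ y, R j y * R k y ∂noiseLaw σ n
      = Real.exp ((∑ l, meanVec n (f j) l * meanVec n (f k) l) / σ ^ 2) := fun j k => by
    simp only [hR, likRatio_mul]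
    rw [integral_const_mul, integral_likRatio hσ, mul_one]
  have hZint : Integrable Z (noiseLaw σ n) := (integrable_finsetSum _ fun k _ => hRint k).const_mul _
  have hZ1 : ∫ y, Z y ∂noiseLaw σ n = 1 := by
    rw [hZ, integral_const_mul, integral_finsetSum _ fun k _ => hRint k]
    simp only [hR, integral_likRatio hσ]
    simp [hm0.ne']
  have hZsq : ∀ y, Z y ^ 2 = (m : ℝ)⁻¹ ^ 2 * ∑ j, ∑ k, R j y * R k y := fun y => by
    rw [hZ, mul_pow, sq (∑ k, R k y), Finset.sum_mul_sum]
  have hZ2int : Integrable (fun y => Z y ^ 2) (noiseLaw σ n) := by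
    simp only [hZsq]
    exact (integrable_finsetSum _ fun j _ => integrable_finsetSum _ fun k _ => hRR j k).const_mul _
  have hZ2 : ∫ y, Z y ^ 2 ∂noiseLaw σ n ≤ 1 + ε ^ 2 := by
    simp only [hZsq]
    rw [integral_const_mul, integral_finsetSum _ fun j _ => integrable_finsetSum _ fun k _ => hRR j k]
    have h1 : ∀ j, ∫ y, ∑ k, R j y * R k y ∂noiseLaw σ n ≤ m + Real.exp Q := by
      intro j
      rw [integral_finsetSum _ fun k _ => hRR j k]
      have h2 : ∀ k, ∫ y, R j y * R k y ∂noiseLaw σ n ≤ 1 + if j = k then Real.exp Q else 0 := by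
        intro k
        rw [hRRval]
        split_ifs with h
        · subst h
          linarith [Real.exp_le_exp.mpr (hQ j)]
        · rw [horth j k h]; simp
      refine (Finset.sum_le_sum fun k _ => h2 k).trans (le_of_eq ?_)
      rw [Finset.sum_add_distrib]
      simp
    have h3 := Finset.sum_le_sum fun j (_ : j ∈ Finset.univ) => h1 j
    rw [Finset.sum_const, Finset.card_univ, Fintype.card_fin, nsmul_eq_mul] at h3
    calc _ ≤ (m : ℝ)⁻¹ ^ 2 * (m * (m + Real.exp Q)) := mul_le_mul_of_nonneg_left h3 (by positivity)
      _ = 1 + Real.exp Q / m := by field_simp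
      _ ≤ _ := by linarith
  have hvar : ∫ y, (Z y - 1) ^ 2 ∂noiseLaw σ n ≤ ε ^ 2 := by
    have : ∀ y, (Z y - 1) ^ 2 = Z y ^ 2 - 2 * Z y + 1 := fun y => by ring
    simp only [this]
    have hsub : Integrable (fun y => Z y ^ 2 - 2 * Z y) (noiseLaw σ n) :=
      hZ2int.sub (hZint.const_mul 2)
    rw [integral_add hsub (integrable_const _),
      integral_sub hZ2int (hZint.const_mul 2), integral_const_mul, hZ1]
    simp
    linarith
  have hvarint : Integrable (fun y => (Z y - 1) ^ 2) (noiseLaw σ n) := by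
    have : ∀ y, (Z y - 1) ^ 2 = Z y ^ 2 - 2 * Z y + 1 := fun y => by ring
    simp only [this]
    exact (hZ2int.sub (hZint.const_mul 2)).add (integrable_const _)
  -- Linearizing the square: `Z ≤ 1 + ε + (Z - 1)² / ε` pointwise.
  have hpt : ∀ y, ENNReal.ofReal (Z y) * Ψ y true
      ≤ Ψ y true + ENNReal.ofReal (ε + ε⁻¹ * (Z y - 1) ^ 2) := by
    intro y
    have h1 : Z y ≤ 1 + (ε + ε⁻¹ * (Z y - 1) ^ 2) := by
      have h2 : 0 ≤ ε⁻¹ * ((Z y - 1) - ε / 2) ^ 2 := by positivity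
      have h3 : ε⁻¹ * ((Z y - 1) - ε / 2) ^ 2
          = ε⁻¹ * (Z y - 1) ^ 2 - (Z y - 1) + ε / 4 := by field_simp; ring
      linarith
    have h4 : 0 ≤ ε + ε⁻¹ * (Z y - 1) ^ 2 := by positivity
    calc _ ≤ ENNReal.ofReal (1 + (ε + ε⁻¹ * (Z y - 1) ^ 2)) * Ψ y true := by gcongr
      _ = Ψ y true + ENNReal.ofReal (ε + ε⁻¹ * (Z y - 1) ^ 2) * Ψ y true := by
          rw [ENNReal.ofReal_add zero_le_one h4, ENNReal.ofReal_one, add_mul, one_mul]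
      _ ≤ _ := by
          gcongr
          exact mul_le_of_le_one_right' ((Ψ y).coe_le_one true)
  have hmix : ∫⁻ y, ENNReal.ofReal (Z y) * Ψ y true ∂noiseLaw σ n
      = ENNReal.ofReal (m : ℝ)⁻¹ * ∑ k, rejProb σ Ψ (f k) := by
    have h1 : ∀ y, ENNReal.ofReal (Z y) * Ψ y true
        = ENNReal.ofReal (m : ℝ)⁻¹ * ∑ k, ENNReal.ofReal (R k y) * Ψ y true := fun y => by
      rw [hZ, ENNReal.ofReal_mul (by positivity),
        ENNReal.ofReal_sum_of_nonneg fun k _ => (likRatio_pos σ _ y).le, mul_assoc, Finset.sum_mul]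
    have h2 : ∀ k, Measurable fun y => ENNReal.ofReal (R k y) * Ψ y true := fun k =>
      (measurable_likRatio σ _).ennreal_ofReal.mul hΨ
    simp only [h1]
    rw [lintegral_const_mul _ (Finset.measurable_fun_sum _ fun k _ => h2 k),
      lintegral_finsetSum _ fun k _ => h2 k]
    simp only [rejProb_eq_lintegral_likRatio hσ Ψ hΨ]
    rfl
  have hbound : ENNReal.ofReal (m : ℝ)⁻¹ * ∑ k, rejProb σ Ψ (f k)
      ≤ rejProb σ Ψ (fun _ => 0) + ENNReal.ofReal (2 * ε) := by
    rw [← hmix]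
    refine (lintegral_mono hpt).trans ?_
    rw [lintegral_add_left hΨ, rejProb, dataLaw_zero]
    gcongr
    have hint : Integrable (fun y => ε + ε⁻¹ * (Z y - 1) ^ 2) (noiseLaw σ n) :=
      (integrable_const _).add (hvarint.const_mul _)
    rw [← ofReal_integral_eq_lintegral_ofReal hint (ae_of_all _ fun y => by positivity)]
    refine ENNReal.ofReal_le_ofReal ?_
    rw [integral_add (integrable_const _) (hvarint.const_mul _), integral_const_mul]
    have : ε⁻¹ * ∫ y, (Z y - 1) ^ 2 ∂noiseLaw σ n ≤ ε⁻¹ * ε ^ 2 :=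
      mul_le_mul_of_nonneg_left hvar (by positivity)
    have e : ε⁻¹ * ε ^ 2 = ε := by field_simp
    simp
    linarith
  by_contra! hcon
  set b := rejProb σ Ψ (fun _ => 0) + ENNReal.ofReal (2 * ε) with hb
  have hlt : ∑ _k : Fin m, b < ∑ k, rejProb σ Ψ (f k) := by
    have : Nonempty (Fin m) := ⟨⟨0, hm⟩⟩
    exact ENNReal.sum_lt_sum_of_nonempty Finset.univ_nonempty fun k _ => hcon k
  have hmul := ENNReal.mul_lt_mul_right (a := ENNReal.ofReal (m : ℝ)⁻¹)
    (ENNReal.ofReal_pos.mpr (by positivity)).ne' ENNReal.ofReal_ne_top hlt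
  refine absurd (hmul.trans_le hbound) (not_lt.mpr (le_of_eq ?_))
  rw [Finset.sum_const, Finset.card_univ, Fintype.card_fin, nsmul_eq_mul, ← mul_assoc,
    ← ENNReal.ofReal_natCast, ← ENNReal.ofReal_mul (by positivity), inv_mul_cancel₀ hm0.ne',
    ENNReal.ofReal_one, one_mul]

end FOMT

/-! ### Bump functions -/

namespace FOMT

/-- The bump `(1 - u²)₊²`. -/
noncomputable def bump (u : ℝ) : ℝ := max 0 (1 - u ^ 2) ^ 2

/-- The derivative `-4 u (1 - u²)₊` of `bump`. -/
noncomputable def bumpDeriv (u : ℝ) : ℝ := -4 * u * max 0 (1 - u ^ 2)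

lemma bump_eq_zero {u : ℝ} (hu : 1 ≤ |u|) : bump u = 0 := by
  have : 1 ≤ u ^ 2 := by rw [← sq_abs]; exact one_le_pow₀ hu
  rw [bump, max_eq_left (by linarith), zero_pow two_ne_zero]

lemma abs_bump_le_one (u : ℝ) : |bump u| ≤ 1 := by
  rw [bump, abs_of_nonneg (sq_nonneg _)]
  exact pow_le_one₀ (le_max_left _ _) (max_le zero_le_one (by nlinarith [sq_nonneg u]))

lemma hasDerivAt_max_zero_sq (t : ℝ) : HasDerivAt (fun t : ℝ => max 0 t ^ 2) (2 * max 0 t) t := by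
  rcases lt_trichotomy t 0 with h | rfl | h
  · rw [max_eq_left h.le, mul_zero]
    refine (hasDerivAt_const t (0 : ℝ)).congr_of_eventuallyEq ?_
    filter_upwards [Iio_mem_nhds h] with s hs
    rw [max_eq_left (le_of_lt hs)]; norm_num
  · rw [max_self, mul_zero, hasDerivAt_iff_isLittleO]
    simp only [max_self, sub_zero, smul_zero, ne_eq, OfNat.ofNat_ne_zero, not_false_eq_true,
      zero_pow]
    refine Asymptotics.IsBigO.trans_isLittleO (g := fun t : ℝ => t ^ 2) ?_
      (by simpa using Asymptotics.isLittleO_pow_pow (𝕜 := ℝ) one_lt_two)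
    refine Asymptotics.isBigO_of_le _ fun t => ?_
    rw [Real.norm_eq_abs, Real.norm_eq_abs, abs_of_nonneg (sq_nonneg _),
      abs_of_nonneg (sq_nonneg _), ← sq_abs t]
    exact pow_le_pow_left₀ (le_max_left _ _) (max_le (abs_nonneg t) (le_abs_self t)) 2
  · rw [max_eq_right h.le]
    have h1 : HasDerivAt (fun t : ℝ => t ^ 2) (2 * t) t := by simpa using hasDerivAt_pow 2 t
    refine h1.congr_of_eventuallyEq ?_
    filter_upwards [Ioi_mem_nhds h] with s hs
    rw [max_eq_right (le_of_lt hs)]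

lemma hasDerivAt_bump (u : ℝ) : HasDerivAt bump (bumpDeriv u) u := by
  have h1 : HasDerivAt (fun u : ℝ => 1 - u ^ 2) (-(2 * u)) u := by
    simpa using (hasDerivAt_pow 2 u).const_sub 1
  have h2 := (hasDerivAt_max_zero_sq (1 - u ^ 2)).comp u h1
  have e : 2 * max 0 (1 - u ^ 2) * -(2 * u) = bumpDeriv u := by rw [bumpDeriv]; ring
  rw [e] at h2
  exact h2

lemma abs_bumpDeriv_le (u : ℝ) : |bumpDeriv u| ≤ 4 := by
  rcases le_or_gt (|u|) 1 with h | h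
  · have h0 : u ^ 2 ≤ 1 := by rw [← sq_abs]; exact pow_le_one₀ (abs_nonneg _) h
    rw [bumpDeriv, max_eq_right (by linarith), abs_mul, abs_mul,
      abs_of_nonneg (by linarith : 0 ≤ 1 - u ^ 2)]
    have h1 : |u| * (1 - u ^ 2) ≤ 1 * 1 :=
      mul_le_mul h (by nlinarith [sq_nonneg u]) (by linarith) zero_le_one
    norm_num
    nlinarith
  · have : 1 ≤ u ^ 2 := by rw [← sq_abs]; exact one_le_pow₀ h.le
    rw [bumpDeriv, max_eq_left (by linarith)]; norm_num

lemma abs_bump_sub_le (u v : ℝ) : |bump u - bump v| ≤ 8 * |u - v| := by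
  have := Convex.norm_image_sub_le_of_norm_hasDerivWithin_le (f := bump) (f' := bumpDeriv)
    (s := Set.univ) (C := 4) (x := v) (y := u) (fun z _ => (hasDerivAt_bump z).hasDerivWithinAt)
    (fun z _ => abs_bumpDeriv_le z) convex_univ (Set.mem_univ _) (Set.mem_univ _)
  simp only [Real.norm_eq_abs] at this
  linarith [abs_nonneg (u - v)]

lemma abs_bumpDeriv_sub_le (u v : ℝ) : |bumpDeriv u - bumpDeriv v| ≤ 8 * |u - v| := by
  have hzero : ∀ w : ℝ, 1 < |w| → bumpDeriv w = 0 := by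
    intro w hw
    have : 1 ≤ w ^ 2 := by rw [← sq_abs]; exact one_le_pow₀ hw.le
    rw [bumpDeriv, max_eq_left (by linarith), mul_zero]
  have hin : ∀ w : ℝ, |w| ≤ 1 → bumpDeriv w = -4 * (w - w ^ 3) := by
    intro w hw
    have : w ^ 2 ≤ 1 := by rw [← sq_abs]; exact pow_le_one₀ (abs_nonneg _) hw
    rw [bumpDeriv, max_eq_right (by linarith)]; ring
  have hmix : ∀ u v : ℝ, |u| ≤ 1 → 1 < |v| → |bumpDeriv u - bumpDeriv v| ≤ 8 * |u - v| := by
    intro u v hu hv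
    rw [hzero v hv, sub_zero, hin u hu, abs_mul]
    have h1 : |v| - |u| ≤ |u - v| := by
      rw [abs_sub_comm]; exact abs_sub_abs_le_abs_sub v u
    have h2 : |u - u ^ 3| = |u| * (1 - |u|) * (1 + |u|) := by
      have : u - u ^ 3 = u * (1 - u ^ 2) := by ring
      rw [this, abs_mul, ← sq_abs u, abs_of_nonneg (a := 1 - |u| ^ 2)
        (by linarith [pow_le_one₀ (n := 2) (abs_nonneg u) hu])]
      ring
    have h3 : |u| * (1 - |u|) * (1 + |u|) ≤ (1 - |u|) * 2 := by
      have := abs_nonneg u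
      refine mul_le_mul ?_ (by linarith) (by linarith) (by linarith)
      nlinarith
    rw [h2]
    norm_num
    linarith
  rcases le_or_gt (|u|) 1 with hu | hu <;> rcases le_or_gt (|v|) 1 with hv | hv
  · rw [hin u hu, hin v hv]
    have e : -4 * (u - u ^ 3) - -4 * (v - v ^ 3)
        = 4 * ((u ^ 2 + u * v + v ^ 2) - 1) * (u - v) := by ring
    rw [e, abs_mul]
    refine mul_le_mul_of_nonneg_right ?_ (abs_nonneg _)
    obtain ⟨hu1, hu2⟩ := abs_le.mp hu
    obtain ⟨hv1, hv2⟩ := abs_le.mp hv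
    rw [abs_le]
    constructor
    · nlinarith [sq_nonneg (u + v), sq_nonneg u, sq_nonneg v]
    · nlinarith [sq_nonneg (u - v)]
  · exact hmix u v hu hv
  · rw [abs_sub_comm, abs_sub_comm u v]; exact hmix v u hv hu
  · rw [hzero u hu, hzero v hv]; simp

/-- A bounded Lipschitz function is Hölder of every order `γ ≤ 1`. -/
lemma abs_sub_le_rpow_of_lipschitz {G : ℝ → ℝ} (hlip : ∀ u v, |G u - G v| ≤ 8 * |u - v|)
    (hbd : ∀ u, |G u| ≤ 4) {γ : ℝ} (h0 : 0 < γ) (h1 : γ ≤ 1) (u v : ℝ) :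
    |G u - G v| ≤ 8 * |u - v| ^ γ := by
  rcases le_or_gt (|u - v|) 1 with h | h
  · refine (hlip u v).trans (mul_le_mul_of_nonneg_left ?_ (by norm_num))
    rcases (abs_nonneg (u - v)).eq_or_lt with h2 | h2
    · rw [← h2, Real.zero_rpow h0.ne']
    · calc |u - v| = |u - v| ^ (1 : ℝ) := (Real.rpow_one _).symm
        _ ≤ _ := Real.rpow_le_rpow_of_exponent_ge h2 h h1
  · have h2 : 1 ≤ |u - v| ^ γ := Real.one_le_rpow h.le h0.le
    have h3 := abs_sub (G u) (G v)
    linarith [hbd u, hbd v]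

/-- The bump of Hölder norm at most `8 A` with centre `x₀` and radius `r`. -/
noncomputable def scaledBump (β A r x₀ x : ℝ) : ℝ := A * r ^ β * bump ((x - x₀) / r)

section ScaledBump

variable {β A r x₀ : ℝ}

lemma abs_sub_scaled_le {G : ℝ → ℝ} (hlip : ∀ u v, |G u - G v| ≤ 8 * |u - v|)
    (hbd : ∀ u, |G u| ≤ 4) {γ : ℝ} (h0 : 0 < γ) (h1 : γ ≤ 1) (hA : 0 ≤ A) (hr : 0 < r) (x y : ℝ) :
    |A * r ^ γ * G ((x - x₀) / r) - A * r ^ γ * G ((y - x₀) / r)| ≤ 8 * A * |x - y| ^ γ := by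
  have hrγ := Real.rpow_pos_of_pos hr γ
  rw [← mul_sub, abs_mul, abs_of_nonneg (by positivity)]
  have h2 := abs_sub_le_rpow_of_lipschitz hlip hbd h0 h1 ((x - x₀) / r) ((y - x₀) / r)
  rw [← sub_div, sub_sub_sub_cancel_right, abs_div, abs_of_pos hr,
    Real.div_rpow (abs_nonneg _) hr.le] at h2
  refine (mul_le_mul_of_nonneg_left h2 (by positivity)).trans (le_of_eq ?_)
  field_simp

lemma hasDerivAt_scaledBump (hr : 0 < r) (x : ℝ) :
    HasDerivAt (scaledBump β A r x₀) (A * r ^ (β - 1) * bumpDeriv ((x - x₀) / r)) x := by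
  have h1 : HasDerivAt (fun x : ℝ => (x - x₀) / r) (1 / r) x :=
    ((hasDerivAt_id x).sub_const x₀).div_const r
  have h2 := ((hasDerivAt_bump ((x - x₀) / r)).comp x h1).const_mul (A * r ^ β)
  have e : A * r ^ β * (bumpDeriv ((x - x₀) / r) * (1 / r))
      = A * r ^ (β - 1) * bumpDeriv ((x - x₀) / r) := by
    rw [Real.rpow_sub_one hr.ne']; field_simp
  rw [e] at h2
  exact h2

lemma derivWithin_scaledBump (hr : 0 < r) {x : ℝ} (hx : x ∈ Icc (0 : ℝ) 1) :
    derivWithin (scaledBump β A r x₀) (Icc 0 1) x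
      = A * r ^ (β - 1) * bumpDeriv ((x - x₀) / r) :=
  (hasDerivAt_scaledBump hr x).hasDerivWithinAt.derivWithin (uniqueDiffOn_Icc_zero_one x hx)

lemma contDiff_scaledBump (hr : 0 < r) : ContDiff ℝ 1 (scaledBump β A r x₀) := by
  rw [contDiff_one_iff_deriv]
  refine ⟨fun x => (hasDerivAt_scaledBump hr x).differentiableAt, ?_⟩
  have : deriv (scaledBump β A r x₀) = fun x => A * r ^ (β - 1) * bumpDeriv ((x - x₀) / r) :=
    funext fun x => (hasDerivAt_scaledBump hr x).deriv
  rw [this]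
  unfold bumpDeriv
  fun_prop

lemma scaledBump_mem_holderClass (hβ : 0 < β) (hβ2 : β ≤ 2) (hA : 0 ≤ A) (hr : 0 < r) :
    scaledBump β A r x₀ ∈ holderClass β (8 * A) := by
  rcases le_or_gt β 1 with h1 | h1
  · rw [mem_holderClass_of_le_one hβ h1]
    refine ⟨(contDiff_scaledBump hr).continuous.continuousOn, fun x _ y _ => ?_⟩
    exact abs_sub_scaled_le abs_bump_sub_le (fun u => (abs_bump_le_one u).trans (by norm_num))
      hβ h1 hA hr x y
  · rw [mem_holderClass_of_one_lt h1 hβ2]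
    refine ⟨(contDiff_scaledBump hr).contDiffOn, fun x hx y hy => ?_⟩
    rw [derivWithin_scaledBump hr hx, derivWithin_scaledBump hr hy]
    exact abs_sub_scaled_le abs_bumpDeriv_sub_le abs_bumpDeriv_le (by linarith) (by linarith)
      hA hr x y

/-- The bump drops by `A r ^ β` from its centre to the end of its support, and its derivative
half-way between them is `-(3/2) A r ^ (β - 1)`. -/
lemma scaledBump_mem_altClass (hβ : 0 < β) (hβ2 : β ≤ 2) (hA : 0 ≤ A) (hr : 0 < r) (h0 : 0 ≤ x₀)
    (h1 : x₀ + r ≤ 1) :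
    scaledBump β A r x₀ ∈ altClass β (8 * A) (A * r ^ (β - (⌈β⌉₊ : ℝ) + 1)) := by
  refine ⟨scaledBump_mem_holderClass hβ hβ2 hA hr, ?_⟩
  split_ifs with hb
  · refine ⟨x₀, x₀ + r, h0, by linarith, h1, ?_⟩
    rw [natCeil_of_le_one hβ hb, show β - ((1 : ℕ) : ℝ) + 1 = β by norm_num, scaledBump, scaledBump,
      sub_self, zero_div, add_sub_cancel_left, div_self hr.ne', bump_eq_zero (u := 1) (by simp)]
    simp [bump]
  · rw [not_le] at hb
    refine ⟨x₀ + r / 2, ⟨by linarith, by linarith⟩, ?_⟩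
    rw [derivWithin_scaledBump hr ⟨by linarith, by linarith⟩, natCeil_of_one_lt hb hβ2,
      show β - ((2 : ℕ) : ℝ) + 1 = β - 1 by norm_num; ring, add_sub_cancel_left,
      div_div_cancel_left' hr.ne', bumpDeriv]
    have := mul_nonneg hA (Real.rpow_pos_of_pos hr (β - 1)).le
    norm_num
    linarith

lemma scaledBump_eq_zero (hr : 0 < r) {x : ℝ} (hx : r ≤ |x - x₀|) : scaledBump β A r x₀ x = 0 := by
  rw [scaledBump, bump_eq_zero, mul_zero]
  rwa [abs_div, abs_of_pos hr, one_le_div hr]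

lemma sum_scaledBump_sq_le (hr : 0 < r) {n : ℕ} (hnr : 1 ≤ n * r) :
    ∑ l, meanVec n (scaledBump β A r x₀) l * meanVec n (scaledBump β A r x₀) l
      ≤ 3 * A ^ 2 * (n * r ^ (2 * β + 1)) := by
  have h1 : ∀ l : Fin n, meanVec n (scaledBump β A r x₀) l * meanVec n (scaledBump β A r x₀) l
      ≤ if |design n (l + 1) - x₀| ≤ r then (A * r ^ β) ^ 2 else 0 := by
    intro l
    rw [meanVec]
    split_ifs with h
    · rw [← sq, scaledBump, mul_pow]
      have := abs_bump_le_one ((design n (l + 1) - x₀) / r)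
      have h2 : bump ((design n (l + 1) - x₀) / r) ^ 2 ≤ 1 := by
        rw [← sq_abs]; exact pow_le_one₀ (abs_nonneg _) this
      exact mul_le_of_le_one_right (sq_nonneg _) h2
    · rw [scaledBump_eq_zero hr (not_le.mp h).le, zero_mul]
  refine (Finset.sum_le_sum fun l _ => h1 l).trans ?_
  rw [← Finset.sum_filter, Finset.sum_const, nsmul_eq_mul]
  have h2 := card_design_le n x₀ hr.le
  have h3 : ((Finset.univ.filter fun l : Fin n => |design n (l + 1) - x₀| ≤ r).card : ℝ)
      ≤ 3 * (n * r) := by linarith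
  refine (mul_le_mul_of_nonneg_right h3 (sq_nonneg _)).trans (le_of_eq ?_)
  rw [Real.rpow_add_one hr.ne', two_mul, Real.rpow_add hr]
  ring

lemma sum_scaledBump_mul_eq_zero (hr : 0 < r) {x₁ : ℝ} (h : 2 * r ≤ |x₀ - x₁|) (n : ℕ) :
    ∑ l, meanVec n (scaledBump β A r x₀) l * meanVec n (scaledBump β A r x₁) l = 0 := by
  refine Finset.sum_eq_zero fun l _ => ?_
  rw [meanVec, meanVec]
  rcases le_or_gt r (|design n (l + 1) - x₀|) with h1 | h1
  · rw [scaledBump_eq_zero hr h1, zero_mul]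
  · rw [scaledBump_eq_zero (x₀ := x₁) hr, mul_zero]
    have := abs_sub_le x₀ (design n (l + 1)) x₁
    rw [abs_sub_comm x₀ (design n (l + 1))] at this
    linarith

end ScaledBump

/-! ### Indistinguishability -/

lemma zero_mem_nullClass {β L : ℝ} (hβ : 0 < β) (hβ2 : β ≤ 2) (hL : 0 ≤ L) :
    (fun _ => 0 : ℝ → ℝ) ∈ nullClass β L := by
  refine ⟨?_, monotoneOn_const⟩
  rcases le_or_gt β 1 with h1 | h1
  · rw [mem_holderClass_of_le_one hβ h1]
    refine ⟨continuousOn_const, fun x _ y _ => ?_⟩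
    rw [sub_self, abs_zero]; positivity
  · rw [mem_holderClass_of_one_lt h1 hβ2]
    refine ⟨contDiffOn_const, fun x _ y _ => ?_⟩
    simp only [derivWithin_fun_const, Pi.zero_apply, sub_self, abs_zero]; positivity

lemma tendsto_log_div_rpow_mul :
    Tendsto (fun n : ℕ => 4 * ((n : ℝ) ^ (1 / 10 : ℝ) * (Real.log n / n) ^ (1 / 5 : ℝ)))
      atTop (nhds 0) := by
  have h1 : Tendsto (fun n : ℕ => Real.log n / (n : ℝ) ^ (1 / 2 : ℝ)) atTop (nhds 0) :=
    ((isLittleO_log_rpow_atTop (by norm_num : (0 : ℝ) < 1 / 2)).tendsto_div_nhds_zero).comp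
      tendsto_natCast_atTop_atTop
  have h2 := (h1.rpow_const (p := (1 / 5 : ℝ)) (Or.inr (by norm_num))).const_mul 4
  rw [Real.zero_rpow (by norm_num), mul_zero] at h2
  refine h2.congr' ?_
  filter_upwards [eventually_ge_atTop 2] with n hn
  have hn0 : (0 : ℝ) < n := by positivity
  have hl : 0 ≤ Real.log n := Real.log_nonneg (by exact_mod_cast (by omega : 1 ≤ n))
  congr 1
  rw [Real.div_rpow hl (by positivity), Real.div_rpow hl hn0.le, ← Real.rpow_mul hn0.le]
  have h3 : (n : ℝ) ^ (1 / 10 : ℝ) * (n : ℝ) ^ (1 / 2 * (1 / 5) : ℝ) = (n : ℝ) ^ (1 / 5 : ℝ) := by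
    rw [← Real.rpow_add hn0]; norm_num
  have := Real.rpow_pos_of_pos hn0 (1 / 5)
  have := Real.rpow_pos_of_pos hn0 (1 / 2 * (1 / 5))
  rw [← h3]
  field_simp

/-- With radius `ρ (log n / n) ^ (1 / (2 β + 1))`, `ρ` small, the bumps around `(2 k + 1) r`
have norms of order `√(log n)` with a small constant, while there are at least `n ^ (1/5)` of them
up to logarithms, so that no test separates all of them from `0`. -/
theorem exists_eventually_iInf_rejProb_le {β L σ : ℝ} (hβ : 0 < β) (hβ2 : β ≤ 2) (hL : 0 < L)
    (hσ : 0 < σ) :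
    ∃ c : ℝ, 0 < c ∧ ∀ ε : ℝ, 0 < ε → ∀ᶠ n : ℕ in atTop, ∀ Ψ : RandTest n,
      (Measurable fun y => Ψ y true) →
      ⨅ f ∈ altClass β L (c * sepRate β n), rejProb σ Ψ f
        ≤ rejProb σ Ψ (fun _ => 0) + ENNReal.ofReal (2 * ε) := by
  set A := L / 8 with hA
  have hA0 : 0 < A := by positivity
  set ρ := min 1 (σ ^ 2 / (30 * A ^ 2)) with hρ
  have hρ0 : 0 < ρ := lt_min one_pos (by positivity)
  have hρ1 : ρ ≤ 1 := min_le_left _ _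
  have hρ2 : 3 * A ^ 2 * ρ ^ (2 * β + 1) / σ ^ 2 ≤ 1 / 10 := by
    have h1 : ρ ^ (2 * β + 1) ≤ σ ^ 2 / (30 * A ^ 2) := by
      refine le_trans ?_ (min_le_right 1 _)
      calc ρ ^ (2 * β + 1) ≤ ρ ^ (1 : ℝ) :=
            Real.rpow_le_rpow_of_exponent_ge hρ0 hρ1 (by linarith)
        _ = _ := Real.rpow_one _
    rw [le_div_iff₀ (by positivity)] at h1
    rw [div_le_iff₀ (by positivity)]
    linarith
  refine ⟨A * ρ ^ (β - (⌈β⌉₊ : ℝ) + 1), by positivity, fun ε hε => ?_⟩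
  have hexp0 : (0 : ℝ) < 1 / (2 * β + 1) := by positivity
  have hrlim : Tendsto (fun n : ℕ => ρ * (Real.log n / n) ^ (1 / (2 * β + 1))) atTop (nhds 0) := by
    have := (tendsto_log_div_nat.rpow_const (p := 1 / (2 * β + 1)) (Or.inr hexp0.le)).const_mul ρ
    rwa [Real.zero_rpow hexp0.ne', mul_zero] at this
  have hloglim : Tendsto (fun n : ℕ => ρ ^ (2 * β + 1) * Real.log n) atTop atTop :=
    (Real.tendsto_log_atTop.comp tendsto_natCast_atTop_atTop).const_mul_atTop
      (Real.rpow_pos_of_pos hρ0 _)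
  filter_upwards [eventually_ge_atTop 2, hrlim.eventually_le_const (by norm_num : (0 : ℝ) < 1 / 4),
    hloglim.eventually_ge_atTop 1, tendsto_log_div_nat.eventually_le_const one_pos,
    tendsto_log_div_rpow_mul.eventually_le_const (by positivity : 0 < ε ^ 2)]
    with n hn hr4 hlog1 hlog2 hχ Ψ hΨ
  have hl := log_div_pos hn
  have hn0 : (0 : ℝ) < n := by positivity
  set r := ρ * (Real.log n / n) ^ (1 / (2 * β + 1)) with hrdef
  have hr : 0 < r := by positivity
  have hnr : n * r ^ (2 * β + 1) = ρ ^ (2 * β + 1) * Real.log n := by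
    rw [hrdef, Real.mul_rpow hρ0.le (by positivity), ← Real.rpow_mul hl.le,
      one_div_mul_cancel (by positivity), Real.rpow_one]
    field_simp
  have hnr1 : 1 ≤ n * r := by
    rw [← hnr] at hlog1
    refine hlog1.trans (mul_le_mul_of_nonneg_left ?_ hn0.le)
    calc r ^ (2 * β + 1) ≤ r ^ (1 : ℝ) :=
          Real.rpow_le_rpow_of_exponent_ge hr (by linarith) (by linarith)
      _ = r := Real.rpow_one r
  have hrate : A * ρ ^ (β - (⌈β⌉₊ : ℝ) + 1) * sepRate β n = A * r ^ (β - (⌈β⌉₊ : ℝ) + 1) := by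
    rw [sepRate, hrdef, Real.mul_rpow hρ0.le (by positivity), ← Real.rpow_mul hl.le,
      one_div_mul_eq_div, mul_assoc]
  set m := ⌊1 / (2 * r)⌋₊ with hm
  have hm1 : (m : ℝ) ≤ 1 / (2 * r) := Nat.floor_le (by positivity)
  have hm2 : 1 / (4 * r) ≤ m := by
    have h1 := Nat.lt_floor_add_one (1 / (2 * r))
    have h2 : 1 / (2 * r) = 1 / (4 * r) + 1 / (4 * r) := by field_simp; norm_num
    have h3 : 1 ≤ 1 / (4 * r) := by rw [le_div_iff₀ (by positivity)]; linarith
    rw [← hm] at h1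
    linarith
  have hm0 : (0 : ℝ) < m := lt_of_lt_of_le (by positivity) hm2
  rw [le_div_iff₀ (by positivity)] at hm1
  set centre : Fin m → ℝ := fun k => (2 * (k : ℕ) + 1) * r with hcentre
  obtain ⟨k, hk⟩ := exists_rejProb_le hσ (n := n) (m := m) (by exact_mod_cast hm0)
    (fun k => scaledBump β A r (centre k)) (Q := 1 / 10 * Real.log n) (ε := ε) (by
      intro j k hjk
      refine sum_scaledBump_mul_eq_zero hr ?_ n
      have e : centre j - centre k = 2 * r * (((j : ℕ) : ℤ) - ((k : ℕ) : ℤ) : ℤ) := by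
        simp only [hcentre]; push_cast; ring
      rw [e, abs_mul, abs_of_pos (by positivity : 0 < 2 * r)]
      have h1 : (1 : ℝ) ≤ |((((j : ℕ) : ℤ) - ((k : ℕ) : ℤ) : ℤ) : ℝ)| := by
        have : (1 : ℤ) ≤ |((j : ℕ) : ℤ) - ((k : ℕ) : ℤ)| := by
          refine Int.one_le_abs fun h => hjk (Fin.ext ?_)
          omega
        exact_mod_cast this
      nlinarith) (by
      intro k
      refine (div_le_div_of_nonneg_right (sum_scaledBump_sq_le hr hnr1) (sq_nonneg σ)).trans ?_
      rw [hnr]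
      have hl0 : 0 ≤ Real.log n := Real.log_nonneg (by exact_mod_cast (by omega : 1 ≤ n))
      calc _ = 3 * A ^ 2 * ρ ^ (2 * β + 1) / σ ^ 2 * Real.log n := by ring
        _ ≤ _ := mul_le_mul_of_nonneg_right hρ2 hl0) hε (by
      have h1 : Real.exp (1 / 10 * Real.log n) = (n : ℝ) ^ (1 / 10 : ℝ) := by
        rw [Real.rpow_def_of_pos hn0, mul_comm]
      have h2 : r ≤ (Real.log n / n) ^ (1 / 5 : ℝ) := by
        calc r ≤ 1 * (Real.log n / n) ^ (1 / (2 * β + 1)) :=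
              mul_le_mul_of_nonneg_right hρ1 (by positivity)
          _ = (Real.log n / n) ^ (1 / (2 * β + 1)) := one_mul _
          _ ≤ _ := Real.rpow_le_rpow_of_exponent_ge hl hlog2
              (one_div_le_one_div_of_le (by positivity) (by linarith))
      rw [h1, div_le_iff₀ hm0]
      have h3 : (n : ℝ) ^ (1 / 10 : ℝ) * (4 * r) ≤ ε ^ 2 := by
        refine le_trans ?_ hχ
        have := mul_le_mul_of_nonneg_left h2 (Real.rpow_nonneg hn0.le (1 / 10))
        linarith
      have h4 : 1 ≤ m * (4 * r) := by
        rwa [div_le_iff₀ (by positivity)] at hm2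
      calc (n : ℝ) ^ (1 / 10 : ℝ) ≤ (n : ℝ) ^ (1 / 10 : ℝ) * (m * (4 * r)) :=
            le_mul_of_one_le_right (by positivity) h4
        _ = ((n : ℝ) ^ (1 / 10 : ℝ) * (4 * r)) * m := by ring
        _ ≤ _ := mul_le_mul_of_nonneg_right h3 hm0.le) Ψ hΨ
  refine le_trans (iInf₂_le _ ?_) hk
  rw [hrate]
  have h8 : L = 8 * A := by rw [hA]; ring
  rw [h8]
  have hkm : ((k : ℕ) : ℝ) + 1 ≤ m := by exact_mod_cast k.isLt
  refine scaledBump_mem_altClass hβ hβ2 hA0.le hr (by positivity) ?_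
  have := mul_le_mul_of_nonneg_right hkm (by positivity : 0 ≤ 2 * r)
  simp only [hcentre]
  linarith

end FOMT

theorem mainTheorem1 (p : FOMT.Params) (hp : p.Admissible) :
    ∃ c C : ℝ, 0 < c ∧ c < C ∧ ∀ α : ℝ, 0 < α → α < 1 →
      ENNReal.ofReal (1 - α) ≤
          liminf (fun n : ℕ =>
            ⨅ f ∈ FOMT.altClass p.β p.L (C * FOMT.sepRate p.β n),
              FOMT.rejProb p.σ (p.fomt α n) f) atTop ∧
        ∀ Ψ : (n : ℕ) → FOMT.RandTest n,
          (∀ n : ℕ, Measurable fun y : Fin n → ℝ => Ψ n y true) →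
          limsup (fun n : ℕ =>
            ⨆ f ∈ FOMT.nullClass p.β p.L, FOMT.rejProb p.σ (Ψ n) f) atTop ≤ ENNReal.ofReal α →
          limsup (fun n : ℕ =>
            ⨅ f ∈ FOMT.altClass p.β p.L (c * FOMT.sepRate p.β n),
              FOMT.rejProb p.σ (Ψ n) f) atTop ≤ ENNReal.ofReal α := by
  obtain ⟨C₀, hC₀⟩ := hp.le_liminf_rejProb
  obtain ⟨c, hc, hlow⟩ :=
    FOMT.exists_eventually_iInf_rejProb_le hp.β_pos hp.β_le hp.L_pos hp.σ_pos
  refine ⟨c, max C₀ (c + 1), hc, by linarith [le_max_right C₀ (c + 1)], fun α hα hα1 =>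
    ⟨hC₀ _ (le_max_left _ _) α hα hα1, fun Ψ hΨ hlevel => ?_⟩⟩
  refine ENNReal.le_of_forall_pos_le_add fun ε hε _ => ?_
  have hε0 : (0 : ℝ) < ε := hε
  have hlt : limsup (fun n : ℕ => ⨆ f ∈ FOMT.nullClass p.β p.L, FOMT.rejProb p.σ (Ψ n) f) atTop
      < ENNReal.ofReal α + ENNReal.ofReal (ε / 2) :=
    hlevel.trans_lt (ENNReal.lt_add_right ENNReal.ofReal_ne_top
      (ENNReal.ofReal_pos.mpr (by positivity)).ne')
  refine limsup_le_of_le (by isBoundedDefault) ?_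
  filter_upwards [eventually_lt_of_limsup_lt hlt, hlow (ε / 4) (by positivity)] with n hn hn'
  have hzero : FOMT.rejProb p.σ (Ψ n) (fun _ => 0)
      ≤ ⨆ f ∈ FOMT.nullClass p.β p.L, FOMT.rejProb p.σ (Ψ n) f :=
    le_iSup₂ (f := fun f (_ : f ∈ FOMT.nullClass p.β p.L) => FOMT.rejProb p.σ (Ψ n) f)
      (fun _ => 0) (FOMT.zero_mem_nullClass hp.β_pos hp.β_le hp.L_pos.le)
  calc _ ≤ _ := hn' (Ψ n) (hΨ n)
    _ ≤ ENNReal.ofReal α + ENNReal.ofReal (ε / 2) + ENNReal.ofReal (2 * (ε / 4)) := by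
        gcongr
        exact hzero.trans hn.le
    _ = ENNReal.ofReal α + ε := by
        rw [add_assoc, ← ENNReal.ofReal_add (by positivity) (by positivity),
          show (ε : ℝ) / 2 + 2 * (ε / 4) = ε by ring, ENNReal.ofReal_coe_nnreal]
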